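/- **Model.** Algorithms run on a deterministic word RAM. For a word size $w$, the machine stores words of $w$ bits in finitely many registers (initially $0$) and in finitely many random access arrays, each with $2^w$ cells addressed by words and with arbitrary (uninitialized) initial content. Unit-cost instructions are: loading a constant, reading and writing memory, reading the read-only input, conditional jumps on $x=y$ and on $x<y$, output of a triple of words, and the binary word operations (modulo $2^w$) of a fixed set $S$. Here $S$ is any subset of $\{$addition, subtraction, multiplication, division, remainder, bitwise and/or/xor, left/right shift$\}$ that contains addition and subtraction. An algorithm is a single program, working for inputs of every size. Word size in $\Omega(\log N)$ means that there is a constant $k$ such that the program is correct and meets its time bounds for every word size $w \ge k\lfloor\log_2(N+2)\rfloor$, where $N$ is the number of vertices, respectively the dimension of the matrices. **Reachable-APSD enumeration.** The input is an unweighted loopless graph $G$ with vertices $0,\dots,n-1$ and $m$ edges, given by read-only adjacency lists (neighbours in any order), with constant time access to $n$, to the degree of each vertex, and to the $i$-th neighbour of each vertex. The degree of a vertex is the number of its outgoing edges, and $\overline\Delta$ is the average degree. An undirected graph is treated as a symmetric directed one, $m$ being the number of unordered edges. With $d(u,v)$ the least number of edges of a path from $u$ to $v$ ($\infty$ if there is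 none), the algorithm has to output every triple $(u,v,d(u,v))$ with $d(u,v)<\infty$ exactly once (self-distances $(u,u,0)$ included) and then halt. It has preprocessing in $O(n+m)$ and delay in $O(\overline\Delta)$ if there is a constant $C$ such that, on every input, the first output (or halting, if there is no output) happens after at most $C(n+m+1)+C(1+\overline\Delta)$ steps, and the time between consecutive outputs, as well as between the last output and halting, is at most $C(1+\overline\Delta)$ steps. (The $1$ is added since no delay is below one step, whereas $\overline\Delta$ may be arbitrarily small.) **Boolean matrix multiplication (BMM).** Given $d$ and two Boolean $d\times d$ matrices $A,B$ as read-only input with constant time access to entries, write all entries $(A\cdot B)[i,k]=\bigvee_j A[i,j]\wedge B[j,k]$ to an output array and halt. It is solved in $O(d^2)$ total time if there is a constant $C$ such that this takes at most $C(d^2+1)$ steps for all $d, A, B$. **Theorem.** For each such set $S$ of operations, and for directed as well as for undirected graphs: no algorithm can solve reachable-APSD enumeration with delay in $O(\overline{\Delta})$ and preprocessing in $O(n+m)$, unless $d\times d$ Boolean matrix multiplication can be solved in $O(d^2)$ total time. -/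

import Mathlib

/-! ## The word RAM -/

namespace WordRAM

/-- Binary word operations that a word RAM may provide at unit cost. -/
inductive BinOp
  | add | sub | mul | div | mod | and | or | xor | shl | shr

/-- All operations act on words of `w` bits and wrap around modulo `2 ^ w`. -/
def BinOp.eval {w : ℕ} : BinOp → BitVec w → BitVec w → BitVec w
  | .add, x, y => x + y
  | .sub, x, y => x - y
  | .mul, x, y => x * y
  | .div, x, y => x / y
  | .mod, x, y => x % y
  | .and, x, y => x &&& y
  | .or, x, y => x ||| y
  | .xor, x, y => x ^^^ y
  | .shl, x, y => x <<< y.toNat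
  | .shr, x, y => x >>> y.toNat

/-- Instructions. Registers `r`, memory arrays `a`, tables `k` of the read-only input and jump
targets `l` are named by natural numbers that are fixed in the program; a program is finite, so it
uses finitely many registers and arrays. -/
inductive Instr
  /-- `const r c` : `r := c` -/
  | const (r c : ℕ)
  /-- `op o r x y` : `r := x o y` -/
  | op (o : BinOp) (r x y : ℕ)
  /-- `load r a x` : `r := a[x]` -/
  | load (r a x : ℕ)
  /-- `store a x y` : `a[x] := y` -/
  | store (a x y : ℕ)
  /-- `input r k x y` : `r := k[x, y]`, a read of the input table `k` -/
  | input (r k x y : ℕ)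
  /-- `emit x y z` : output the triple `(x, y, z)` -/
  | emit (x y z : ℕ)
  /-- `jumpEq x y l` : go to instruction `l` if `x = y` -/
  | jumpEq (x y l : ℕ)
  /-- `jumpLt x y l` : go to instruction `l` if `x < y` -/
  | jumpLt (x y l : ℕ)

abbrev Program := List Instr

/-- The read-only input of a machine with word size `w`: tables indexed by two words. -/
abbrev Input (w : ℕ) := ℕ → BitVec w → BitVec w → BitVec w

/-- The random access memory of a machine with word size `w`: arrays of `2 ^ w` words each. -/
abbrev Memory (w : ℕ) := ℕ → BitVec w → BitVec w

structure Config (w : ℕ) where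
  /-- the number of the next instruction -/
  pc : ℕ
  reg : ℕ → BitVec w
  mem : Memory w
  /-- the triples that have been output so far, in order -/
  out : List (ℕ × ℕ × ℕ)

/-- The memory is uninitialized: its content `μ` at the start is arbitrary. -/
def Config.init {w : ℕ} (μ : Memory w) : Config w :=
  { pc := 0, reg := fun _ => 0, mem := μ, out := [] }

/-- The effect of a single instruction. -/
def Instr.exec {w : ℕ} (inp : Input w) (c : Config w) : Instr → Config w
  | .const r v =>
      { c with pc := c.pc + 1, reg := Function.update c.reg r (BitVec.ofNat w v) }
  | .op o r x y =>
      { c with pc := c.pc + 1, reg := Function.update c.reg r (o.eval (c.reg x) (c.reg y)) }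
  | .load r a x =>
      { c with pc := c.pc + 1, reg := Function.update c.reg r (c.mem a (c.reg x)) }
  | .store a x y =>
      { c with
        pc := c.pc + 1
        mem := Function.update c.mem a (Function.update (c.mem a) (c.reg x) (c.reg y)) }
  | .input r k x y =>
      { c with pc := c.pc + 1, reg := Function.update c.reg r (inp k (c.reg x) (c.reg y)) }
  | .emit x y z =>
      { c with
        pc := c.pc + 1
        out := c.out ++ [((c.reg x).toNat, (c.reg y).toNat, (c.reg z).toNat)] }
  | .jumpEq x y l => { c with pc := if c.reg x = c.reg y then l else c.pc + 1 }
  | .jumpLt x y l => { c with pc := if (c.reg x).toNat < (c.reg y).toNat then l else c.pc + 1 }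

/-- The machine halts when it leaves the program. -/
def Halted {w : ℕ} (P : Program) (c : Config w) : Prop := P.length ≤ c.pc

/-- One step, at unit cost; a halted machine does not change any more. -/
def step {w : ℕ} (P : Program) (inp : Input w) (c : Config w) : Config w :=
  match P[c.pc]? with
  | some i => i.exec inp c
  | none => c

/-- The configuration after `t` steps, when started on initial memory content `μ`. -/
def run {w : ℕ} (P : Program) (inp : Input w) (μ : Memory w) (t : ℕ) : Config w :=
  (step P inp)^[t] (Config.init μ)

/-- The program is written for a word RAM that provides the operations in `S`. -/
def UsesOnly (S : Set BinOp) (P : Program) : Prop :=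
  ∀ o r x y, Instr.op o r x y ∈ P → o ∈ S

/-- Started on `μ`, the program halts, and its outputs are the elements of `X`, each one being
output exactly once. -/
def Enumerates {w : ℕ} (P : Program) (inp : Input w) (μ : Memory w) (X : Set (ℕ × ℕ × ℕ)) :
    Prop :=
  ∃ T, Halted P (run P inp μ T) ∧ (run P inp μ T).out.Nodup ∧
    ∀ x, x ∈ (run P inp μ T).out ↔ x ∈ X

/-- Preprocessing time at most `pre` and delay at most `D`: from the end of the preprocessing
phase, and also from every time after the first output, it takes at most `D` steps until
the next output or until the machine halts. -/
def HasDelay {w : ℕ} (P : Program) (inp : Input w) (μ : Memory w) (pre : ℕ) (D : ℚ) : Prop :=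
  ∀ t, ¬ Halted P (run P inp μ t) → (pre ≤ t ∨ (run P inp μ t).out ≠ []) →
    ∃ s : ℕ, (s : ℚ) ≤ t + D ∧
      (Halted P (run P inp μ s) ∨ (run P inp μ t).out.length < (run P inp μ s).out.length)

end WordRAM

/-! ## Graphs and distances -/

namespace APSD

/-- `HasWalk G k u v` : there is a directed walk with `k` edges from `u` to `v`. -/
def HasWalk {V : Type*} (G : Digraph V) : ℕ → V → V → Prop
  | 0, u, v => u = v
  | k + 1, u, v => ∃ x, G.Adj u x ∧ HasWalk G k x v

/-- The distance `d(u, v)`: the least number of edges of a walk from `u` to `v`, and `⊤` if `v` is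
not reachable from `u`. -/
noncomputable def gdist {V : Type*} (G : Digraph V) (u v : V) : ℕ∞ :=
  ⨅ (k : ℕ) (_ : HasWalk G k u v), (k : ℕ∞)

inductive GraphKind
  | directed
  | undirected

/-- Graphs have no loops; an undirected graph is one with a symmetric adjacency relation. -/
def GraphKind.Admits {V : Type*} (κ : GraphKind) (G : Digraph V) : Prop :=
  (∀ v, ¬ G.Adj v v) ∧
    match κ with
    | .directed => True
    | .undirected => ∀ u v, G.Adj u v → G.Adj v u

/-- The number `m` of edges: ordered pairs in a directed graph, unordered pairs in an undirected
graph. -/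
noncomputable def GraphKind.numEdges {V : Type*} (κ : GraphKind) (G : Digraph V) : ℕ :=
  match κ with
  | .directed => {p : V × V | G.Adj p.1 p.2}.ncard
  | .undirected => {e : Sym2 V | ∃ u v, e = s(u, v) ∧ G.Adj u v}.ncard

/-- The degree of a vertex is the number of its outgoing edges. -/
noncomputable def outDegree {V : Type*} (G : Digraph V) (v : V) : ℕ := {x | G.Adj v x}.ncard

noncomputable def avgDegree {n : ℕ} (G : Digraph (Fin n)) : ℚ :=
  (∑ v, (outDegree G v : ℚ)) / n

/-- `adj v` lists the neighbours of `v`, in some order. -/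
def IsAdjLists {n : ℕ} (G : Digraph (Fin n)) (adj : Fin n → List (Fin n)) : Prop :=
  ∀ v, (adj v).Nodup ∧ ∀ x, x ∈ adj v ↔ G.Adj v x

/-- Adjacency lists as the read-only input of a word RAM: table `0` holds the number of
vertices, table `1` the degrees, and entry `[v, i]` of table `2` is the `i`-th neighbour of `v`. -/
def graphInput {n : ℕ} (adj : Fin n → List (Fin n)) (w : ℕ) : WordRAM.Input w
  | 0, _, _ => BitVec.ofNat w n
  | 1, x, _ => if h : x.toNat < n then BitVec.ofNat w (adj ⟨x.toNat, h⟩).length else 0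
  | 2, x, y =>
      if h : x.toNat < n then
        match (adj ⟨x.toNat, h⟩)[y.toNat]? with
        | some v => BitVec.ofNat w v
        | none => 0
      else 0
  | _, _, _ => 0

/-- The triples `(u, v, d(u, v))` with `d(u, v) < ∞`. -/
def reachableTriples {n : ℕ} (G : Digraph (Fin n)) : Set (ℕ × ℕ × ℕ) :=
  {x | ∃ u v : Fin n, x.1 = u ∧ x.2.1 = v ∧ gdist G u v = (x.2.2 : ℕ∞)}

/-- `P` solves reachable-APSD enumeration on unweighted graphs of kind `κ`, with `n` vertices and
`m` edges, with preprocessing in `O(n + m)` and delay in `O(1 + average degree)`, on a word RAM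
with word size in `Ω(log n)`. -/
def SolvesReachableAPSD (κ : GraphKind) (P : WordRAM.Program) : Prop :=
  ∃ k C : ℕ, ∀ (n : ℕ) (G : Digraph (Fin n)) (adj : Fin n → List (Fin n)),
    κ.Admits G → IsAdjLists G adj →
    ∀ w : ℕ, k * Nat.log 2 (n + 2) ≤ w → ∀ μ : WordRAM.Memory w,
      WordRAM.Enumerates P (graphInput adj w) μ (reachableTriples G) ∧
      WordRAM.HasDelay P (graphInput adj w) μ
        (C * (n + κ.numEdges G + 1)) (C * (1 + avgDegree G))

end APSD

/-! ## Boolean matrix multiplication -/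

namespace BMM

/-- The Boolean product: entry `(i, j)` is `⋁ l, A i l ∧ B l j`. -/
def boolMul {d : ℕ} (A B : Matrix (Fin d) (Fin d) Bool) : Matrix (Fin d) (Fin d) Bool :=
  Matrix.of fun i j => decide (∃ l, A i l = true ∧ B l j = true)

/-- Entry `[i, j]` of a Boolean matrix, as a word `0` or `1`. -/
def entry {d : ℕ} (A : Matrix (Fin d) (Fin d) Bool) (w : ℕ) (x y : BitVec w) : BitVec w :=
  if h : x.toNat < d ∧ y.toNat < d then
    (if A ⟨x.toNat, h.1⟩ ⟨y.toNat, h.2⟩ then BitVec.ofNat w 1 else 0)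
  else 0

/-- Two matrices as the read-only input of a word RAM: table `0` holds the dimension, tables `1`
and `2` hold the two matrices. -/
def matrixInput {d : ℕ} (A B : Matrix (Fin d) (Fin d) Bool) (w : ℕ) : WordRAM.Input w
  | 0, _, _ => BitVec.ofNat w d
  | 1, x, y => entry A w x y
  | 2, x, y => entry B w x y
  | _, _, _ => 0

/-- `Q` multiplies Boolean `d × d` matrices in `O(d ^ 2)` total time on a word RAM with word size
in `Ω(log d)`: after at most `C * (d ^ 2 + 1)` steps it has halted, and memory array `0`
holds the product, row by row, starting at address `0`. -/
def SolvesInQuadraticTime (Q : WordRAM.Program) : Prop :=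
  ∃ k C : ℕ, ∀ (d : ℕ) (A B : Matrix (Fin d) (Fin d) Bool),
    ∀ w : ℕ, k * Nat.log 2 (d + 2) ≤ w → ∀ μ : WordRAM.Memory w,
      ∃ T ≤ C * (d ^ 2 + 1),
        WordRAM.Halted Q (WordRAM.run Q (matrixInput A B w) μ T) ∧
        ∀ i j : Fin d,
          ((WordRAM.run Q (matrixInput A B w) μ T).mem 0
            (BitVec.ofNat w (i * d + j))).toNat = if boolMul A B i j then 1 else 0

end BMM

/-! ## Loop-free code and its compilation -/

/-! The proof is a reduction: an enumeration algorithm `P` with these bounds yields a program that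
multiplies Boolean matrices `A`, `B` in quadratic time.

The core of the graph joins row `i` to a middle vertex `j` if `A i j`, and `j` to column `k` if `B j
k`. Row `i` and column `k` are never adjacent, so they have distance two iff entry `(i, k)` of the
product is true. On this core alone the `j`-th neighbour of a vertex could not be found in constant
time. Hence each layer gets a twin: for a pair `(i, j)` the entry `A i j` chooses between the two
perfect matchings of {row `i`, its twin} with {middle `j`, its twin}, and likewise for `B`. Rows
with their twins are layers 1 and 2, columns with theirs are layers 4 and 5; the middle layer 0 has
the twin 3 with respect to `A` and the twin 6 with respect to `B`. Now degrees are fixed, each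
adjacency query costs one matrix entry, and no new walk of length two leads from a row to a column
(`exists_nbr_nbr_iff`, `mem_reachableTriples_iff`). The graph is symmetric, so it serves both graph
kinds.

Adding `d * d` isolated vertices brings the average degree down to a constant (`avgDegree_le`),
while the number of vertices, of edges and of reachable pairs stays in `O(d ^ 2)`: an isolated
vertex contributes only its self-distance. Preprocessing plus number of outputs times delay is then
`O(d ^ 2)` (`HasDelay.exists_halted`).

It remains to run `P` on a graph that is never written down. Each instruction of `P` becomes a block
of bounded length; input reads are answered from the matrices, and an output turns into a mark in
the product array (`simulates_step`). Only addition and subtraction are used besides the operations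
of `P`, so row offsets are tabulated in advance by repeated addition (`initProgram_reaches`). Word
size is shared by both machines, as `log` of the number of vertices is within a constant factor of
`log d` (`log_order_le`). -/

namespace WordRAM

/-- Registers and memory of a machine, without program counter and output. -/
structure Store (w : ℕ) where
  reg : ℕ → BitVec w
  mem : Memory w

/-- The configuration with program counter `p` that has not output anything. -/
def Store.toConfig {w : ℕ} (s : Store w) (p : ℕ) : Config w := ⟨p, s.reg, s.mem, []⟩

theorem Store.exec_jumpLt {w : ℕ} (inp : Input w) (s : Store w) (x y l p : ℕ) :
    (Instr.jumpLt x y l).exec inp (s.toConfig p) =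
      s.toConfig (if (s.reg x).toNat < (s.reg y).toNat then l else p + 1) := rfl

theorem Store.exec_jumpEq {w : ℕ} (inp : Input w) (s : Store w) (x y l p : ℕ) :
    (Instr.jumpEq x y l).exec inp (s.toConfig p) =
      s.toConfig (if s.reg x = s.reg y then l else p + 1) := rfl

/-- Assign a register. -/
def Store.set {w : ℕ} (s : Store w) (r : ℕ) (v : BitVec w) : Store w :=
  ⟨Function.update s.reg r v, s.mem⟩

@[simp] theorem Store.set_mem {w : ℕ} (s : Store w) (r : ℕ) (v : BitVec w) :
    (s.set r v).mem = s.mem := rfl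

@[simp] theorem Store.set_reg_self {w : ℕ} (s : Store w) (r : ℕ) (v : BitVec w) :
    (s.set r v).reg r = v := by simp [Store.set]

theorem Store.set_reg_of_ne {w : ℕ} (s : Store w) {r r' : ℕ} (v : BitVec w) (h : r' ≠ r) :
    (s.set r v).reg r' = s.reg r' := by simp [Store.set, h]

theorem Store.set_reg {w : ℕ} (s : Store w) (r r' : ℕ) (v : BitVec w) :
    (s.set r v).reg r' = if r' = r then v else s.reg r' := by
  simp [Store.set, Function.update_apply]

/-- Loop-free structured code. -/
inductive Code
  | skip
  | const (r c : ℕ)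
  | op (o : BinOp) (r x y : ℕ)
  | load (r a x : ℕ)
  | store (a x y : ℕ)
  | input (r k x y : ℕ)
  | seq (a b : Code)
  | ifLt (x y : ℕ) (a b : Code)
  | ifEq (x y : ℕ) (a b : Code)

infixr:60 " ;; " => Code.seq

namespace Code

def len : Code → ℕ
  | skip => 0
  | const _ _ | op _ _ _ _ | load _ _ _ | store _ _ _ | input _ _ _ _ => 1
  | seq a b => a.len + b.len
  | ifLt _ _ a b | ifEq _ _ a b => a.len + b.len + 2

/-- The instructions for a piece of code that is placed at address `p`. -/
def compile : Code → ℕ → List Instr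
  | skip, _ => []
  | const r c, _ => [.const r c]
  | op o r x y, _ => [.op o r x y]
  | load r a x, _ => [.load r a x]
  | store a x y, _ => [.store a x y]
  | input r k x y, _ => [.input r k x y]
  | seq a b, p => a.compile p ++ b.compile (p + a.len)
  | ifLt x y a b, p =>
      .jumpLt x y (p + 1 + b.len + 1) ::
        (b.compile (p + 1) ++
          .jumpEq x x (p + 1 + b.len + 1 + a.len) :: a.compile (p + 1 + b.len + 1))
  | ifEq x y a b, p =>
      .jumpEq x y (p + 1 + b.len + 1) ::
        (b.compile (p + 1) ++
          .jumpEq x x (p + 1 + b.len + 1 + a.len) :: a.compile (p + 1 + b.len + 1))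

@[simp] theorem length_compile (c : Code) (p : ℕ) : (c.compile p).length = c.len := by
  induction c generalizing p <;> simp_all [compile, len] <;> omega

def eval {w : ℕ} (inp : Input w) : Code → Store w → Store w
  | skip, s => s
  | const r c, s => s.set r (BitVec.ofNat w c)
  | op o r x y, s => s.set r (o.eval (s.reg x) (s.reg y))
  | load r a x, s => s.set r (s.mem a (s.reg x))
  | store a x y, s =>
      ⟨s.reg, Function.update s.mem a (Function.update (s.mem a) (s.reg x) (s.reg y))⟩
  | input r k x y, s => s.set r (inp k (s.reg x) (s.reg y))
  | seq a b, s => b.eval inp (a.eval inp s)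
  | ifLt x y a b, s => if (s.reg x).toNat < (s.reg y).toNat then a.eval inp s else b.eval inp s
  | ifEq x y a b, s => if s.reg x = s.reg y then a.eval inp s else b.eval inp s

/-- All word operations that occur belong to `S`. -/
def OpsIn (S : Set BinOp) : Code → Prop
  | op o _ _ _ => o ∈ S
  | seq a b | ifLt _ _ a b | ifEq _ _ a b => a.OpsIn S ∧ b.OpsIn S
  | _ => True

theorem OpsIn.usesOnly {S : Set BinOp} {c : Code} (h : c.OpsIn S) (p : ℕ) :
    UsesOnly S (c.compile p) := by
  induction c generalizing p with
  | seq a b iha ihb =>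
    intro o r x y hm
    rcases List.mem_append.1 hm with hm | hm
    · exact iha h.1 _ _ _ _ _ hm
    · exact ihb h.2 _ _ _ _ _ hm
  | ifLt x y a b iha ihb | ifEq x y a b iha ihb =>
    intro o r x y hm
    simp only [compile, List.mem_cons, List.mem_append, reduceCtorEq, false_or] at hm
    rcases hm with hm | hm
    · exact ihb h.2 _ _ _ _ _ hm
    · exact iha h.1 _ _ _ _ _ hm
  | _ => intro o r x y hm; simp_all [compile, OpsIn]

end Code

/-! ### Code placed inside a program, and execution within a step bound -/

theorem UsesOnly.append {S : Set BinOp} {P Q : Program} (hP : UsesOnly S P)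
    (hQ : UsesOnly S Q) : UsesOnly S (P ++ Q) := fun o r x y h =>
  (List.mem_append.1 h).elim (hP o r x y) (hQ o r x y)

/-- `L` stands in the program `P` at address `p`. -/
def CodeAt (P : Program) (p : ℕ) (L : List Instr) : Prop :=
  ∃ l₁ l₂, P = l₁ ++ (L ++ l₂) ∧ l₁.length = p

theorem CodeAt.left {P : Program} {p : ℕ} {L M : List Instr} (h : CodeAt P p (L ++ M)) :
    CodeAt P p L := by
  obtain ⟨l₁, l₂, rfl, rfl⟩ := h
  exact ⟨l₁, M ++ l₂, by simp, rfl⟩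

theorem CodeAt.right {P : Program} {p : ℕ} {L M : List Instr} (h : CodeAt P p (L ++ M)) :
    CodeAt P (p + L.length) M := by
  obtain ⟨l₁, l₂, rfl, rfl⟩ := h
  exact ⟨l₁ ++ L, l₂, by simp, by simp⟩

theorem CodeAt.tail {P : Program} {p : ℕ} {i : Instr} {L : List Instr}
    (h : CodeAt P p (i :: L)) : CodeAt P (p + 1) L :=
  CodeAt.right (L := [i]) h

theorem CodeAt.head {P : Program} {p : ℕ} {i : Instr} {L : List Instr}
    (h : CodeAt P p (i :: L)) : P[p]? = some i := by
  obtain ⟨l₁, l₂, rfl, rfl⟩ := h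
  simp

theorem CodeAt.step {w : ℕ} {P : Program} {inp : Input w} {i : Instr} {L : List Instr}
    {c : Config w} (h : CodeAt P c.pc (i :: L)) : step P inp c = i.exec inp c := by
  simp [WordRAM.step, h.head]

/-- The machine gets from `c` to `c'` in at most `t` steps. -/
def Reaches {w : ℕ} (P : Program) (inp : Input w) (t : ℕ) (c c' : Config w) : Prop :=
  ∃ n ≤ t, (step P inp)^[n] c = c'

namespace Reaches

variable {w : ℕ} {P : Program} {inp : Input w}

theorem refl (t : ℕ) (c : Config w) : Reaches P inp t c c := ⟨0, t.zero_le, rfl⟩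

theorem mono {t t' : ℕ} {c c' : Config w} (h : Reaches P inp t c c') (ht : t ≤ t') :
    Reaches P inp t' c c' := let ⟨n, hn, e⟩ := h; ⟨n, hn.trans ht, e⟩

theorem congr_pc {t t' q q' : ℕ} {c : Config w} {s : Store w}
    (h : Reaches P inp t c (s.toConfig q)) (ht : t ≤ t') (hq : q = q') :
    Reaches P inp t' c (s.toConfig q') := hq ▸ h.mono ht

theorem trans {t t' : ℕ} {c₁ c₂ c₃ : Config w} (h : Reaches P inp t c₁ c₂)
    (h' : Reaches P inp t' c₂ c₃) : Reaches P inp (t + t') c₁ c₃ := by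
  obtain ⟨n, hn, rfl⟩ := h
  obtain ⟨m, hm, rfl⟩ := h'
  exact ⟨m + n, by omega, Function.iterate_add_apply _ _ _ _⟩

theorem single {c c' : Config w} (h : step P inp c = c') : Reaches P inp 1 c c' :=
  ⟨1, le_rfl, h⟩

theorem exec {i : Instr} {L : List Instr} {c : Config w} (h : CodeAt P c.pc (i :: L)) :
    Reaches P inp 1 c (i.exec inp c) := single h.step

/-- An unconditional jump. -/
theorem jump {x l p : ℕ} {L : List Instr} (h : CodeAt P p (.jumpEq x x l :: L)) (s : Store w) :
    Reaches P inp 1 (s.toConfig p) (s.toConfig l) :=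
  single (by rw [CodeAt.step (c := s.toConfig p) h]; simp [Instr.exec, Store.toConfig])

/-- Compiled code does what `Code.eval` says. -/
theorem code {c : Code} {p : ℕ} (h : CodeAt P p (c.compile p)) (s : Store w) :
    Reaches P inp c.len (s.toConfig p) ((c.eval inp s).toConfig (p + c.len)) := by
  induction c generalizing p s with
  | skip => exact refl _ _
  | const | op | load | store | input =>
    exact single (CodeAt.step (c := s.toConfig p) h)
  | seq a b iha ihb =>
    have h' := h.right
    rw [Code.length_compile] at h'
    have := (iha h.left s).trans (ihb h' _)
    rwa [add_assoc] at this
  | ifLt x y a b iha ihb | ifEq x y a b iha ihb =>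
    have h₁ := h.tail
    have h₂ := h₁.right
    rw [Code.length_compile] at h₂
    have h₃ := h₂.tail
    have e := CodeAt.step (c := s.toConfig p) (inp := inp) h
    simp only [Store.exec_jumpLt, Store.exec_jumpEq] at e
    simp only [Code.eval, Code.len]
    split_ifs with hxy
    · rw [if_pos hxy] at e
      exact ((single e).trans (iha h₃ s)).congr_pc (by omega) (by omega)
    · rw [if_neg hxy] at e
      exact (((single e).trans (ihb h₁.left s)).trans (jump h₂ _)).congr_pc (by omega) (by omega)

/-- A loop that executes `body` as long as `x < y`. -/
def _root_.WordRAM.whileLt (x y : ℕ) (body : Code) (p : ℕ) : List Instr :=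
  .jumpLt x y (p + 1 + 1) :: .jumpEq x x (p + 1 + 1 + body.len + 1) ::
    (body.compile (p + 1 + 1) ++ [.jumpEq x x p])

/-- The stores `s i` before each iteration are supplied by the caller, so termination is the
caller's claim. A round costs the test, the body and the jump back; leaving costs the failed test
and one jump. -/
theorem whileLt {x y : ℕ} {body : Code} {p : ℕ} (h : CodeAt P p (WordRAM.whileLt x y body p))
    (m : ℕ) (s : ℕ → Store w) (hs : ∀ i < m, s (i + 1) = body.eval inp (s i))
    (hlt : ∀ i < m, ((s i).reg x).toNat < ((s i).reg y).toNat)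
    (hm : ¬ ((s m).reg x).toNat < ((s m).reg y).toNat) :
    Reaches P inp (m * (body.len + 2) + 2) ((s 0).toConfig p)
      ((s m).toConfig (p + (body.len + 3))) := by
  have h₁ := h.tail
  have h₂ := h₁.tail
  have h₃ := h₂.right
  rw [Code.length_compile] at h₃
  induction m generalizing s with
  | zero =>
    have e := CodeAt.step (c := (s 0).toConfig p) (inp := inp) h
    simp only [Store.exec_jumpLt] at e
    rw [if_neg hm] at e
    exact ((single e).trans (jump h₁ (s 0))).congr_pc (by omega) (by omega)
  | succ m ih =>
    have e := CodeAt.step (c := (s 0).toConfig p) (inp := inp) h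
    simp only [Store.exec_jumpLt] at e
    rw [if_pos (hlt 0 (by omega))] at e
    have r := ((single e).trans (code h₂.left (s 0))).trans (jump h₃ _)
    rw [← hs 0 (by omega)] at r
    refine (r.trans (ih (fun i => s (i + 1)) (fun i hi => hs _ (by omega))
      (fun i hi => hlt _ (by omega)) hm)).mono ?_
    rw [add_mul]; omega

end Reaches

end WordRAM

/-! ## A graph that encodes a Boolean matrix product -/

namespace APSD.Product

/-- The degree of vertex `x`. The vertices come in seven layers of size `d`, followed by isolated
vertices. -/
def deg (d x : ℕ) : ℕ := if x < d then 2 * d else if x < 7 * d then d else 0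

/-- The `y`-th neighbour of vertex `x`. Rows of `a` are layer 1, columns of `a` and rows of `b` are
layer 0, and columns of `b` are layer 4; every missing edge is replaced by an edge to another
layer, so that degrees do not depend on `a` and `b`. -/
def nbr (d : ℕ) (a b : ℕ → ℕ → Bool) (x y : ℕ) : ℕ :=
  if x < d then
    if y < d then (if a y x then d + y else 2 * d + y)
    else (if b x (y - d) then 4 * d + (y - d) else 5 * d + (y - d))
  else if x < 2 * d then (if a (x - d) y then y else 3 * d + y)
  else if x < 3 * d then (if a (x - 2 * d) y then 3 * d + y else y)
  else if x < 4 * d then (if a y (x - 3 * d) then 2 * d + y else d + y)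
  else if x < 5 * d then (if b y (x - 4 * d) then y else 6 * d + y)
  else if x < 6 * d then (if b y (x - 5 * d) then 6 * d + y else y)
  else (if b (x - 6 * d) y then 5 * d + y else 4 * d + y)

variable {d : ℕ} {a b : ℕ → ℕ → Bool} {x y p : ℕ}

theorem nbr_zero_left (hp : p < d) (hy : y < d) :
    nbr d a b p y = if a y p then d + y else 2 * d + y := by
  unfold nbr; rw [if_pos hp, if_pos hy]

theorem nbr_zero_right (hp : p < d) :
    nbr d a b p (d + y) = if b p y then 4 * d + y else 5 * d + y := by
  unfold nbr; rw [if_pos hp, if_neg (by omega), Nat.add_sub_cancel_left]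

theorem nbr_one (hp : p < d) : nbr d a b (d + p) y = if a p y then y else 3 * d + y := by
  unfold nbr; rw [if_neg (by omega), if_pos (by omega), Nat.add_sub_cancel_left]

theorem nbr_two (hp : p < d) : nbr d a b (2 * d + p) y = if a p y then 3 * d + y else y := by
  unfold nbr
  rw [if_neg (by omega), if_neg (by omega), if_pos (by omega), Nat.add_sub_cancel_left]

theorem nbr_three (hp : p < d) :
    nbr d a b (3 * d + p) y = if a y p then 2 * d + y else d + y := by
  unfold nbr
  rw [if_neg (by omega), if_neg (by omega), if_neg (by omega), if_pos (by omega),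
    Nat.add_sub_cancel_left]

theorem nbr_four (hp : p < d) : nbr d a b (4 * d + p) y = if b y p then y else 6 * d + y := by
  unfold nbr
  rw [if_neg (by omega), if_neg (by omega), if_neg (by omega), if_neg (by omega),
    if_pos (by omega), Nat.add_sub_cancel_left]

theorem nbr_five (hp : p < d) : nbr d a b (5 * d + p) y = if b y p then 6 * d + y else y := by
  unfold nbr
  rw [if_neg (by omega), if_neg (by omega), if_neg (by omega), if_neg (by omega),
    if_neg (by omega), if_pos (by omega), Nat.add_sub_cancel_left]

theorem nbr_six : nbr d a b (6 * d + p) y = if b p y then 5 * d + y else 4 * d + y := by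
  unfold nbr
  rw [if_neg (by omega), if_neg (by omega), if_neg (by omega), if_neg (by omega),
    if_neg (by omega), if_neg (by omega), Nat.add_sub_cancel_left]

theorem deg_zero (hx : x < d) : deg d x = 2 * d := if_pos hx

theorem deg_pos (hx : d ≤ x) (hx' : x < 7 * d) : deg d x = d := by
  unfold deg; rw [if_neg (by omega), if_pos hx']

theorem deg_le : deg d x ≤ if x < 7 * d then 2 * d else 0 := by
  unfold deg; split_ifs <;> omega

theorem lt_of_lt_deg (hy : y < deg d x) : x < 7 * d := by
  unfold deg at hy; split_ifs at hy <;> omega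

/-- The ways in which `y` can be the number of a neighbour of `x`. -/
theorem layer_cases (hy : y < deg d x) :
    (x < d ∧ y < d) ∨ (x < d ∧ ∃ q < d, y = d + q) ∨
      (y < d ∧ ∃ p < d, x = d + p ∨ x = 2 * d + p ∨ x = 3 * d + p ∨ x = 4 * d + p ∨
        x = 5 * d + p ∨ x = 6 * d + p) := by
  unfold deg at hy
  split_ifs at hy with h h'
  · by_cases hy' : y < d
    · exact .inl ⟨h, hy'⟩
    · exact .inr (.inl ⟨h, y - d, by omega, by omega⟩)
  · refine .inr (.inr ⟨hy, ?_⟩)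
    by_cases h2 : x < 2 * d
    · exact ⟨x - d, by omega, by omega⟩
    by_cases h3 : x < 3 * d
    · exact ⟨x - 2 * d, by omega, by omega⟩
    by_cases h4 : x < 4 * d
    · exact ⟨x - 3 * d, by omega, by omega⟩
    by_cases h5 : x < 5 * d
    · exact ⟨x - 4 * d, by omega, by omega⟩
    by_cases h6 : x < 6 * d
    · exact ⟨x - 5 * d, by omega, by omega⟩
    · exact ⟨x - 6 * d, by omega, by omega⟩
  · omega

theorem nbr_lt (hy : y < deg d x) : nbr d a b x y < 7 * d := by
  replace hy := layer_cases hy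
  rcases hy with ⟨hx, hy⟩ | ⟨hx, q, hq, rfl⟩ |
    ⟨hy, p, hp, rfl | rfl | rfl | rfl | rfl | rfl⟩
  · rw [nbr_zero_left hx hy]; split_ifs <;> omega
  · rw [nbr_zero_right hx]; split_ifs <;> omega
  · rw [nbr_one hp]; split_ifs <;> omega
  · rw [nbr_two hp]; split_ifs <;> omega
  · rw [nbr_three hp]; split_ifs <;> omega
  · rw [nbr_four hp]; split_ifs <;> omega
  · rw [nbr_five hp]; split_ifs <;> omega
  · rw [nbr_six]; split_ifs <;> omega

theorem nbr_ne (hy : y < deg d x) : nbr d a b x y ≠ x := by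
  replace hy := layer_cases hy
  rcases hy with ⟨hx, hy⟩ | ⟨hx, q, hq, rfl⟩ |
    ⟨hy, p, hp, rfl | rfl | rfl | rfl | rfl | rfl⟩
  · rw [nbr_zero_left hx hy]; split_ifs <;> omega
  · rw [nbr_zero_right hx]; split_ifs <;> omega
  · rw [nbr_one hp]; split_ifs <;> omega
  · rw [nbr_two hp]; split_ifs <;> omega
  · rw [nbr_three hp]; split_ifs <;> omega
  · rw [nbr_four hp]; split_ifs <;> omega
  · rw [nbr_five hp]; split_ifs <;> omega
  · rw [nbr_six]; split_ifs <;> omega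

/-- A matrix entry selects a matching between a pair of twins and another pair of twins, and both
ends read the same entry. The position of the way back is the offset of `x` in its layer, moved by
`d` for the column half of the list of a vertex in layer 0. -/
theorem nbr_symm (hy : y < deg d x) :
    ∃ z < deg d (nbr d a b x y), nbr d a b (nbr d a b x y) z = x := by
  replace hy := layer_cases hy
  rcases hy with ⟨hx, hy⟩ | ⟨hx, q, hq, rfl⟩ |
    ⟨hy, p, hp, rfl | rfl | rfl | rfl | rfl | rfl⟩
  · rw [nbr_zero_left hx hy]
    refine ⟨x, ?_, ?_⟩ <;> split_ifs with h
    · rwa [deg_pos (by omega) (by omega)]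
    · rwa [deg_pos (by omega) (by omega)]
    · rw [nbr_one hy, if_pos h]
    · rw [nbr_two hy, if_neg h]
  · rw [nbr_zero_right hx]
    refine ⟨x, ?_, ?_⟩ <;> split_ifs with h
    · rwa [deg_pos (by omega) (by omega)]
    · rwa [deg_pos (by omega) (by omega)]
    · rw [nbr_four hq, if_pos h]
    · rw [nbr_five hq, if_neg h]
  · rw [nbr_one hp]
    refine ⟨p, ?_, ?_⟩ <;> split_ifs with h
    · rw [deg_zero hy]; omega
    · rwa [deg_pos (by omega) (by omega)]
    · rw [nbr_zero_left hy hp, if_pos h]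
    · rw [nbr_three hy, if_neg h]
  · rw [nbr_two hp]
    refine ⟨p, ?_, ?_⟩ <;> split_ifs with h
    · rwa [deg_pos (by omega) (by omega)]
    · rw [deg_zero hy]; omega
    · rw [nbr_three hy, if_pos h]
    · rw [nbr_zero_left hy hp, if_neg h]
  · rw [nbr_three hp]
    refine ⟨p, ?_, ?_⟩ <;> split_ifs with h
    · rwa [deg_pos (by omega) (by omega)]
    · rwa [deg_pos (by omega) (by omega)]
    · rw [nbr_two hy, if_pos h]
    · rw [nbr_one hy, if_neg h]
  · rw [nbr_four hp]
    split_ifs with h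
    -- Layer 0 lists its `d` neighbours from `a` first, hence the shift by `d`.
    · exact ⟨d + p, by rw [deg_zero hy]; omega, by rw [nbr_zero_right hy, if_pos h]⟩
    · exact ⟨p, by rwa [deg_pos (by omega) (by omega)], by rw [nbr_six, if_neg h]⟩
  · rw [nbr_five hp]
    split_ifs with h
    · exact ⟨p, by rwa [deg_pos (by omega) (by omega)], by rw [nbr_six, if_pos h]⟩
    · exact ⟨d + p, by rw [deg_zero hy]; omega, by rw [nbr_zero_right hy, if_neg h]⟩
  · rw [nbr_six]
    refine ⟨p, ?_, ?_⟩ <;> split_ifs with h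
    · rwa [deg_pos (by omega) (by omega)]
    · rwa [deg_pos (by omega) (by omega)]
    · rw [nbr_five hy, if_pos h]
    · rw [nbr_four hy, if_neg h]

theorem nbr_inj {z : ℕ} (hy : y < deg d x) (hz : z < deg d x)
    (h : nbr d a b x y = nbr d a b x z) : y = z := by
  unfold nbr at h
  unfold deg at hy hz
  split_ifs at h hy hz <;> omega

/-- There is a path of length two between row `i` and column `k` iff the entry `(i, k)` of the
product is `true`. -/
theorem exists_nbr_nbr_iff {i k : ℕ} (hi : i < d) (hk : k < d) :
    (∃ y < d, ∃ z < deg d (nbr d a b (d + i) y),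
      nbr d a b (nbr d a b (d + i) y) z = 4 * d + k) ↔ ∃ j < d, a i j ∧ b j k := by
  constructor
  · rintro ⟨y, hy, z, hz, h⟩
    rw [nbr_one hi] at h hz
    split_ifs at h hz with ha
    -- Out of layer 0, the first `d` positions lead to layers 1 and 2; only the others can hit layer
    -- 4.
    · rcases lt_or_ge z d with hzd | hzd
      · rw [nbr_zero_left hy hzd] at h; split_ifs at h <;> omega
      · rw [deg_zero hy] at hz
        obtain ⟨z, rfl⟩ := Nat.exists_eq_add_of_le hzd
        rw [nbr_zero_right hy] at h
        split_ifs at h with hb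
        · obtain rfl : z = k := by omega
          exact ⟨y, hy, ha, hb⟩
        · omega
    -- The detour through the twin layer 3 only leads back to layers 1 and 2.
    · rw [deg_pos (by omega) (by omega)] at hz
      rw [nbr_three hy] at h; split_ifs at h <;> omega
  · rintro ⟨j, hj, ha, hb⟩
    refine ⟨j, hj, ?_⟩
    rw [nbr_one hi, if_pos ha]
    exact ⟨d + k, by rw [deg_zero hj]; omega, by rw [nbr_zero_right hj, if_pos hb]⟩

/-- The number of vertices. -/
def order (d : ℕ) : ℕ := d * d + 7 * d

variable (d a b) in
def graph : Digraph (Fin (order d)) where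
  Adj u v := ∃ y < deg d u, nbr d a b u y = v

variable (d a b) in
def adjList (v : Fin (order d)) : List (Fin (order d)) :=
  List.ofFn fun y : Fin (deg d v) =>
    ⟨nbr d a b v y, (nbr_lt y.2).trans_le (Nat.le_add_left _ _)⟩

theorem isAdjLists : IsAdjLists (graph d a b) (adjList d a b) := by
  intro v
  constructor
  · rw [adjList, List.nodup_ofFn]
    intro y z h
    exact Fin.ext (nbr_inj y.2 z.2 (by simpa using h))
  · intro x
    simp only [adjList, List.mem_ofFn', Set.mem_range, graph, Fin.ext_iff]
    exact ⟨fun ⟨y, h⟩ => ⟨y, y.2, h⟩, fun ⟨y, hy, h⟩ => ⟨⟨y, hy⟩, h⟩⟩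

theorem admits (κ : GraphKind) : κ.Admits (graph d a b) := by
  refine ⟨fun v ⟨y, hy, h⟩ => nbr_ne hy h, ?_⟩
  cases κ
  · trivial
  · rintro u v ⟨y, hy, h⟩
    have := nbr_symm (a := a) (b := b) hy
    rwa [h] at this

/-! ### Number of edges, average degree and range of walks -/

theorem ncard_adj_le : {p : Fin (order d) × Fin (order d) | (graph d a b).Adj p.1 p.2}.ncard ≤
    49 * (d * d) := by
  have h : Set.InjOn (fun p : Fin (order d) × Fin (order d) => ((p.1 : ℕ), (p.2 : ℕ)))
      {p | (graph d a b).Adj p.1 p.2} := by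
    rintro ⟨u, v⟩ - ⟨u', v'⟩ - h
    simpa [Fin.ext_iff] using h
  rw [← h.ncard_image]
  refine (Set.ncard_le_ncard (t := (Finset.range (7 * d) ×ˢ Finset.range (7 * d) : Finset _)) ?_
    (Finset.finite_toSet _)).trans ?_
  · rintro _ ⟨⟨u, v⟩, ⟨y, hy, h⟩, rfl⟩
    simp only [Finset.coe_product, Finset.coe_range, Set.mem_prod, Set.mem_Iio]
    exact ⟨lt_of_lt_deg hy, h ▸ nbr_lt hy⟩
  · rw [Set.ncard_coe_finset, Finset.card_product, Finset.card_range]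
    exact le_of_eq (by ring)

theorem numEdges_le (κ : GraphKind) : κ.numEdges (graph d a b) ≤ 49 * (d * d) := by
  cases κ
  · exact ncard_adj_le
  · refine le_trans ?_ (ncard_adj_le (d := d) (a := a) (b := b))
    refine le_trans (Set.ncard_le_ncard (t := (fun p => s(p.1, p.2)) ''
      {p : Fin (order d) × Fin (order d) | (graph d a b).Adj p.1 p.2}) ?_ (Set.toFinite _))
      (Set.ncard_image_le (Set.toFinite _))
    rintro e ⟨u, v, rfl, h⟩
    exact ⟨(u, v), h, rfl⟩

theorem outDegree_le (v : Fin (order d)) :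
    outDegree (graph d a b) v ≤ if (v : ℕ) < 7 * d then 2 * d else 0 := by
  refine le_trans ?_ deg_le
  have h : {x | (graph d a b).Adj v x} ⊆ ((adjList d a b v).toFinset : Set (Fin (order d))) :=
    fun x hx => by simpa using ((isAdjLists v).2 x).2 hx
  refine (Set.ncard_le_ncard h (Finset.finite_toSet _)).trans ?_
  rw [Set.ncard_coe_finset]
  exact (List.toFinset_card_le _).trans (by simp [adjList])

/-- The `7 * d` vertices in the layers have degree at most `2 * d`, and the isolated vertices push
the number of vertices to at least `d * d`. -/
theorem avgDegree_le : avgDegree (graph d a b) ≤ 14 := by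
  unfold avgDegree
  refine div_le_of_le_mul₀ (by positivity) (by positivity) ?_
  have h : ∑ v, outDegree (graph d a b) v ≤ 14 * order d := by
    calc ∑ v, outDegree (graph d a b) v
        ≤ ∑ v : Fin (order d), if (v : ℕ) < 7 * d then 2 * d else 0 :=
          Finset.sum_le_sum fun v _ => outDegree_le v
      _ = ∑ v ∈ Finset.range (order d), if v < 7 * d then 2 * d else 0 :=
          Fin.sum_univ_eq_sum_range (fun v => if v < 7 * d then 2 * d else 0) _
      _ = ∑ v ∈ Finset.range (order d) with v < 7 * d, 2 * d := (Finset.sum_filter _ _).symm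
      _ ≤ ∑ v ∈ Finset.range (7 * d), 2 * d :=
          Finset.sum_le_sum_of_subset fun v => by simp
      _ = 14 * (d * d) := by simp; ring
      _ ≤ 14 * order d := Nat.mul_le_mul_left _ (Nat.le_add_right _ _)
  exact_mod_cast h

theorem lt_or_eq_of_hasWalk {k : ℕ} {u v : Fin (order d)} (h : HasWalk (graph d a b) k u v) :
    u = v ∨ ((u : ℕ) < 7 * d ∧ (v : ℕ) < 7 * d) := by
  induction k generalizing u with
  | zero => exact .inl h
  | succ k ih =>
    obtain ⟨x, ⟨y, hy, e⟩, h⟩ := h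
    refine .inr ⟨lt_of_lt_deg hy, ?_⟩
    rcases ih h with rfl | h
    · exact e ▸ nbr_lt hy
    · exact h.2

end APSD.Product

/-! ### Distance two, and the number of reachable pairs -/

namespace APSD

theorem exists_hasWalk_of_gdist {V : Type*} {G : Digraph V} {u v : V} {k : ℕ}
    (h : gdist G u v = k) : HasWalk G k u v := by
  have hne : {m : ℕ | HasWalk G m u v}.Nonempty := by
    by_contra hne
    rw [Set.not_nonempty_iff_eq_empty, Set.eq_empty_iff_forall_notMem] at hne
    have : gdist G u v = ⊤ := by
      unfold gdist
      exact iInf_eq_top.2 fun m => iInf_eq_top.2 fun hm => (hne m hm).elim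
    simp [this] at h
  have hmem := Nat.sInf_mem hne
  have : gdist G u v = (sInf {m : ℕ | HasWalk G m u v} : ℕ) := by
    refine le_antisymm (iInf₂_le _ hmem) (le_iInf₂ fun m hm => ?_)
    exact_mod_cast Nat.sInf_le hm
  rw [this, Nat.cast_inj] at h
  exact h ▸ hmem

theorem gdist_eq_two_iff {V : Type*} {G : Digraph V} {u v : V} (hne : u ≠ v)
    (hadj : ¬ G.Adj u v) : gdist G u v = (2 : ℕ) ↔ HasWalk G 2 u v := by
  refine ⟨exists_hasWalk_of_gdist, fun h => ?_⟩
  refine le_antisymm (iInf₂_le 2 h) (le_iInf₂ fun m hm => ?_)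
  match m, hm with
  | 0, hm => exact (hne hm).elim
  | 1, ⟨x, hx, e⟩ => exact (hadj ((show x = v from e) ▸ hx)).elim
  | m + 2, _ => exact_mod_cast (by omega : 2 ≤ m + 2)

namespace Product

variable {d : ℕ} {a b : ℕ → ℕ → Bool}

theorem mem_reachableTriples_iff {i k : ℕ} (hi : i < d) (hk : k < d) :
    (d + i, 4 * d + k, 2) ∈ reachableTriples (graph d a b) ↔ ∃ j < d, a i j ∧ b j k := by
  have hle : 7 * d ≤ order d := Nat.le_add_left _ _
  have key : ((d + i, 4 * d + k, 2) ∈ reachableTriples (graph d a b)) ↔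
      gdist (graph d a b) ⟨d + i, by omega⟩ ⟨4 * d + k, by omega⟩ = (2 : ℕ) := by
    constructor
    · rintro ⟨u, v, hu, hv, h⟩
      rwa [← Fin.ext (a := ⟨d + i, by omega⟩) hu, ← Fin.ext (a := ⟨4 * d + k, by omega⟩) hv] at h
    · exact fun h => ⟨_, _, rfl, rfl, h⟩
  rw [key, gdist_eq_two_iff]
  · have := exists_nbr_nbr_iff (a := a) (b := b) hi hk
    rw [← this]
    constructor
    · rintro ⟨x, ⟨y, hy, h⟩, x', ⟨z, hz, h'⟩, rfl⟩
      rw [deg_pos (by simp) (by simp; omega)] at hy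
      rw [← h] at hz h'
      exact ⟨y, hy, z, hz, h'⟩
    · rintro ⟨y, hy, z, hz, h⟩
      have hy' : y < deg d (d + i) := by rwa [deg_pos (by omega) (by omega)]
      exact ⟨⟨_, (nbr_lt hy').trans_le hle⟩, ⟨y, hy', rfl⟩, _, ⟨z, hz, h⟩, rfl⟩
  · simp; omega
  · rintro ⟨y, hy, h⟩
    simp only at hy h
    rw [deg_pos (by omega) (by omega)] at hy
    rw [nbr_one hi] at h
    split_ifs at h <;> omega

/-- A triple is determined by its pair of vertices, since distances are unique. The pair is either
diagonal or lies inside the seven layers, because walks never touch isolated vertices except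
trivially. -/
theorem length_le_of_mem_reachableTriples {l : List (ℕ × ℕ × ℕ)} (hl : l.Nodup)
    (h : ∀ x ∈ l, x ∈ reachableTriples (graph d a b)) : l.length ≤ order d + 49 * (d * d) := by
  have hinj : ∀ x ∈ l, ∀ y ∈ l, (x.1, x.2.1) = (y.1, y.2.1) → x = y := by
    intro x hx y hy e
    obtain ⟨u, v, hu, hv, huv⟩ := h x hx
    obtain ⟨u', v', hu', hv', huv'⟩ := h y hy
    simp only [Prod.mk.injEq] at e
    obtain rfl : u = u' := Fin.ext (by omega)
    obtain rfl : v = v' := Fin.ext (by omega)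
    rw [huv, Nat.cast_inj] at huv'
    exact Prod.ext e.1 (Prod.ext e.2 huv')
  rw [← List.toFinset_card_of_nodup hl]
  calc l.toFinset.card
      ≤ ((Finset.range (order d)).image (fun v => (v, v)) ∪
          Finset.range (7 * d) ×ˢ Finset.range (7 * d)).card := by
        refine Finset.card_le_card_of_injOn (fun x => (x.1, x.2.1)) ?_ ?_
        · intro x hx
          obtain ⟨u, v, hu, hv, huv⟩ := h x (by simpa using hx)
          simp only [Finset.coe_union, Set.mem_union, Finset.mem_coe, Finset.mem_image,
            Finset.mem_range, Finset.mem_product, hu, hv]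
          rcases lt_or_eq_of_hasWalk (exists_hasWalk_of_gdist huv) with rfl | h
          · exact .inl ⟨u, u.2, rfl⟩
          · exact .inr h
        · intro x hx y hy e
          exact hinj x (by simpa using hx) y (by simpa using hy) e
    _ ≤ order d + 49 * (d * d) := by
        refine (Finset.card_union_le _ _).trans (add_le_add ?_ ?_)
        · exact Finset.card_image_le.trans (by simp)
        · rw [Finset.card_product, Finset.card_range]; exact le_of_eq (by ring)

end Product

end APSD

/-! ## Reading the graph from the matrices -/

namespace APSD.Product

open WordRAM BMM

/-- A Boolean matrix as a function on natural numbers. -/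
def extend {d : ℕ} (M : Matrix (Fin d) (Fin d) Bool) (i j : ℕ) : Bool :=
  if h : i < d ∧ j < d then M ⟨i, h.1⟩ ⟨j, h.2⟩ else false

theorem entry_eq {d w : ℕ} (M : Matrix (Fin d) (Fin d) Bool) (x y : BitVec w) :
    entry M w x y = if extend M x.toNat y.toNat then BitVec.ofNat w 1 else BitVec.ofNat w 0 := by
  unfold entry extend
  split_ifs <;> simp_all

theorem boolMul_iff {d : ℕ} (A B : Matrix (Fin d) (Fin d) Bool) (i k : Fin d) :
    boolMul A B i k = true ↔ ∃ j < d, extend A i j ∧ extend B j k := by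
  simp only [boolMul, Matrix.of_apply, decide_eq_true_eq]
  constructor
  · rintro ⟨l, h⟩
    exact ⟨l, l.2, by simpa [extend] using h⟩
  · rintro ⟨j, hj, h⟩
    exact ⟨⟨j, hj⟩, by simpa [extend, hj] using h⟩

theorem graphInput_one {d w : ℕ} (a b : ℕ → ℕ → Bool) (x y : BitVec w) :
    graphInput (adjList d a b) w 1 x y = BitVec.ofNat w (deg d x.toNat) := by
  simp only [graphInput, adjList, List.length_ofFn]
  split_ifs with h
  · rfl
  · have : 7 * d ≤ x.toNat := (Nat.le_add_left _ _).trans (not_lt.1 h)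
    have h0 : deg d x.toNat = 0 := by
      unfold deg; rw [if_neg (by omega), if_neg (by omega)]
    rw [h0]; rfl

/-- All words `x`, `y` are covered, since the simulated program may also read outside the adjacency
lists and must then see the default value `0`. -/
theorem graphInput_two {d w : ℕ} (a b : ℕ → ℕ → Bool) (x y : BitVec w) :
    graphInput (adjList d a b) w 2 x y =
      BitVec.ofNat w (if y.toNat < deg d x.toNat then nbr d a b x.toNat y.toNat else 0) := by
  simp only [graphInput, adjList]
  split_ifs with h h' h'
  · simp [h']
  · simp [h']
  · have := lt_of_lt_deg h'
    exact (h (this.trans_le (Nat.le_add_left _ _))).elim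
  · rfl

/-- The registers that hold constants, and the row offsets in array `1`. -/
structure Setup {w : ℕ} (d : ℕ) (s : Store w) : Prop where
  zero : s.reg 0 = BitVec.ofNat w 0
  one : s.reg 1 = BitVec.ofNat w 1
  two : s.reg 2 = BitVec.ofNat w 2
  layer1 : s.reg 3 = BitVec.ofNat w d
  layer2 : s.reg 4 = BitVec.ofNat w (2 * d)
  layer3 : s.reg 5 = BitVec.ofNat w (3 * d)
  layer4 : s.reg 6 = BitVec.ofNat w (4 * d)
  layer5 : s.reg 7 = BitVec.ofNat w (5 * d)
  layer6 : s.reg 8 = BitVec.ofNat w (6 * d)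
  layer7 : s.reg 9 = BitVec.ofNat w (7 * d)
  order : s.reg 10 = BitVec.ofNat w (order d)
  rows : ∀ i < d, s.mem 1 (BitVec.ofNat w i) = BitVec.ofNat w (i * d)

/-- `s'` differs from `s` only in the scratch registers. -/
def Frame {w : ℕ} (s s' : Store w) : Prop :=
  s'.mem = s.mem ∧ ∀ r, r ≤ 10 ∨ 16 ≤ r → s'.reg r = s.reg r

variable {w d : ℕ} {s s' s'' : Store w}

theorem Frame.refl : Frame s s := ⟨rfl, fun _ _ => rfl⟩

theorem Frame.trans (h : Frame s s') (h' : Frame s' s'') : Frame s s'' :=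
  ⟨h'.1.trans h.1, fun r hr => (h'.2 r hr).trans (h.2 r hr)⟩

theorem Frame.set {r : ℕ} (h : Frame s s') (v : BitVec w) (hr : 10 < r) (hr' : r < 16) :
    Frame s (s'.set r v) :=
  ⟨h.1, fun q hq => by rw [Store.set_reg_of_ne _ _ (by omega)]; exact h.2 q hq⟩

theorem Setup.of_eq (h : Setup d s) (hr : ∀ r ≤ 10, s'.reg r = s.reg r)
    (hm : s'.mem 1 = s.mem 1) : Setup d s' where
  zero := (hr 0 (by omega)).trans h.zero
  one := (hr 1 (by omega)).trans h.one
  two := (hr 2 (by omega)).trans h.two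
  layer1 := (hr 3 (by omega)).trans h.layer1
  layer2 := (hr 4 (by omega)).trans h.layer2
  layer3 := (hr 5 (by omega)).trans h.layer3
  layer4 := (hr 6 (by omega)).trans h.layer4
  layer5 := (hr 7 (by omega)).trans h.layer5
  layer6 := (hr 8 (by omega)).trans h.layer6
  layer7 := (hr 9 (by omega)).trans h.layer7
  order := (hr 10 (by omega)).trans h.order
  rows := by rw [hm]; exact h.rows

theorem Setup.frame (h : Setup d s) (hf : Frame s s') : Setup d s' :=
  h.of_eq (fun r hr => hf.2 r (.inl hr)) (by rw [hf.1])

theorem toNat_reg {r v : ℕ} (hw : order d + 2 < 2 ^ w) (hr : s.reg r = BitVec.ofNat w v)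
    (hv : v ≤ order d) : (s.reg r).toNat = v := by
  rw [hr, BitVec.toNat_ofNat, Nat.mod_eq_of_lt (by omega)]

theorem sub_eq_ofNat {x y : BitVec w} (h : y.toNat ≤ x.toNat) :
    x - y = BitVec.ofNat w (x.toNat - y.toNat) := by
  apply BitVec.eq_of_toNat_eq
  rw [BitVec.toNat_sub_of_le h, BitVec.toNat_ofNat, Nat.mod_eq_of_lt (by omega)]

/-- Register `13` gets `base₁ + y` or `base₂ + y`, depending on entry `(row, col)` of input
table `k`. -/
def readCode (k row col base₁ base₂ y : ℕ) : Code :=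
  .input 12 k row col ;; .ifEq 12 0 (.op .add 13 base₂ y) (.op .add 13 base₁ y)

/-- Register `12` receives the matrix entry, which is why `y` and the base registers must avoid it.
-/
theorem readCode_eval {inp : Input w} {M : Matrix (Fin d) (Fin d) Bool} {k row col base₁ base₂ y : ℕ}
    {i j v₁ v₂ v : ℕ} (hinp : inp k = entry M w) (hw : order d + 2 < 2 ^ w)
    (h0 : s.reg 0 = BitVec.ofNat w 0) (hi : (s.reg row).toNat = i) (hj : (s.reg col).toNat = j)
    (h₁ : s.reg base₁ = BitVec.ofNat w v₁) (h₂ : s.reg base₂ = BitVec.ofNat w v₂)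
    (hv : (s.reg y).toNat = v) (hb₁ : base₁ ≤ 10) (hb₂ : base₂ ≤ 10) (hy : y ≠ 12) :
    Frame s ((readCode k row col base₁ base₂ y).eval inp s) ∧
      ((readCode k row col base₁ base₂ y).eval inp s).reg 13 =
        BitVec.ofNat w (if extend M i j then v₁ + v else v₂ + v) := by
  have hv' : s.reg y = BitVec.ofNat w v := by rw [← hv, BitVec.ofNat_toNat, BitVec.setWidth_eq]
  have h1 : BitVec.ofNat w 1 ≠ BitVec.ofNat w 0 := fun e => by
    have := congrArg BitVec.toNat e
    rw [BitVec.toNat_ofNat, BitVec.toNat_ofNat, Nat.mod_eq_of_lt (by omega),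
      Nat.mod_eq_of_lt (by omega)] at this
    omega
  simp only [readCode, Code.eval, BinOp.eval, Store.set_reg_self, hinp, entry_eq, hi, hj,
    Store.set_reg_of_ne _ _ (show (0 : ℕ) ≠ 12 by omega), h0,
    Store.set_reg_of_ne _ _ (show base₁ ≠ 12 by omega),
    Store.set_reg_of_ne _ _ (show base₂ ≠ 12 by omega), Store.set_reg_of_ne _ _ hy, h₁, h₂, hv',
    ← BitVec.ofNat_add]
  by_cases h : extend M i j = true
  · rw [if_pos h, if_neg h1, if_pos h]
    exact ⟨(Frame.refl.set _ (by omega) (by omega)).set _ (by omega) (by omega), by simp⟩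
  · rw [if_neg h, if_neg h, if_pos rfl]
    exact ⟨(Frame.refl.set _ (by omega) (by omega)).set _ (by omega) (by omega), by simp⟩

/-- Register `13` gets the `Y`-th neighbour of vertex `X`, if there is one. -/
def layerCode (X Y : ℕ) : Code :=
  .ifLt X 3
    (.ifLt Y 3 (readCode 1 Y X 3 4 Y)
      (.ifLt Y 4 (.op .sub 11 Y 3 ;; readCode 2 X 11 6 7 11) .skip))
    (.ifLt Y 3
      (.ifLt X 4 (.op .sub 11 X 3 ;; readCode 1 11 Y 0 5 Y)
      (.ifLt X 5 (.op .sub 11 X 4 ;; readCode 1 11 Y 5 0 Y)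
      (.ifLt X 6 (.op .sub 11 X 5 ;; readCode 1 Y 11 4 3 Y)
      (.ifLt X 7 (.op .sub 11 X 6 ;; readCode 2 Y 11 0 8 Y)
      (.ifLt X 8 (.op .sub 11 X 7 ;; readCode 2 Y 11 8 0 Y)
      (.ifLt X 9 (.op .sub 11 X 8 ;; readCode 2 11 Y 7 6 Y) .skip))))))
      .skip)

/-- Register `13` gets the `Y`-th neighbour of vertex `X`, or `0` if there is none. -/
def nbrCode (X Y : ℕ) : Code := .const 13 0 ;; layerCode X Y

/-- Register `13` gets the degree of vertex `X`. -/
def degCode (X : ℕ) : Code :=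
  .ifLt X 3 (.op .add 13 4 0) (.ifLt X 9 (.op .add 13 3 0) (.const 13 0))

theorem Setup.toNat (h : Setup d s) (hw : Product.order d + 2 < 2 ^ w) :
    (s.reg 3).toNat = d ∧ (s.reg 4).toNat = 2 * d ∧ (s.reg 5).toNat = 3 * d ∧
      (s.reg 6).toNat = 4 * d ∧ (s.reg 7).toNat = 5 * d ∧ (s.reg 8).toNat = 6 * d ∧
      (s.reg 9).toNat = 7 * d := by
  have : 7 * d ≤ Product.order d := Nat.le_add_left _ _
  exact ⟨toNat_reg hw h.layer1 (by omega), toNat_reg hw h.layer2 (by omega),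
    toNat_reg hw h.layer3 (by omega), toNat_reg hw h.layer4 (by omega),
    toNat_reg hw h.layer5 (by omega), toNat_reg hw h.layer6 (by omega),
    toNat_reg hw h.layer7 (by omega)⟩

theorem degCode_eval {inp : Input w} (hw : order d + 2 < 2 ^ w) (hs : Setup d s) (X : ℕ) :
    Frame s ((degCode X).eval inp s) ∧
      ((degCode X).eval inp s).reg 13 = BitVec.ofNat w (deg d (s.reg X).toNat) := by
  obtain ⟨t3, -, -, -, -, -, t9⟩ := hs.toNat hw
  simp only [degCode, Code.eval, t3, t9, deg]
  split_ifs
  · exact ⟨Frame.refl.set _ (by omega) (by omega), by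
      simp [BinOp.eval, hs.zero, hs.layer2]⟩
  · exact ⟨Frame.refl.set _ (by omega) (by omega), by
      simp [BinOp.eval, hs.zero, hs.layer1]⟩
  · exact ⟨Frame.refl.set _ (by omega) (by omega), by simp⟩

theorem sub_readCode_eval {inp : Input w} {M : Matrix (Fin d) (Fin d) Bool}
    {k row col base₁ base₂ y X D x u i j v₁ v₂ v : ℕ} (hinp : inp k = entry M w)
    (hw : order d + 2 < 2 ^ w) (h0 : s.reg 0 = BitVec.ofNat w 0) (hX : (s.reg X).toNat = x)
    (hD : (s.reg D).toNat = u) (hu : u ≤ x)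
    (hi : ((s.set 11 (BitVec.ofNat w (x - u))).reg row).toNat = i)
    (hj : ((s.set 11 (BitVec.ofNat w (x - u))).reg col).toNat = j)
    (h₁ : s.reg base₁ = BitVec.ofNat w v₁) (h₂ : s.reg base₂ = BitVec.ofNat w v₂)
    (hv : ((s.set 11 (BitVec.ofNat w (x - u))).reg y).toNat = v)
    (hb₁ : base₁ ≤ 10) (hb₂ : base₂ ≤ 10) (hy : y ≠ 12) :
    Frame s ((Code.op .sub 11 X D ;; readCode k row col base₁ base₂ y).eval inp s) ∧
      ((Code.op .sub 11 X D ;; readCode k row col base₁ base₂ y).eval inp s).reg 13 =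
        BitVec.ofNat w (if extend M i j then v₁ + v else v₂ + v) := by
  have hf : Frame s (s.set 11 (BitVec.ofNat w (x - u))) :=
    Frame.refl.set _ (by omega) (by omega)
  have e : s.reg X - s.reg D = BitVec.ofNat w (x - u) := by
    subst hX hD; exact sub_eq_ofNat hu
  simp only [Code.eval, BinOp.eval, e]
  have := readCode_eval hinp hw ((hf.2 0 (by omega)).trans h0) hi hj
    ((hf.2 base₁ (.inl hb₁)).trans h₁) ((hf.2 base₂ (.inl hb₂)).trans h₂) hv hb₁ hb₂ hy
  exact ⟨hf.trans this.1, this.2⟩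

/-- The branches of the code follow the case distinction of `nbr`. Where no neighbour exists the
code does nothing, so the initial `0` in register `13` survives as the default value. -/
theorem layerCode_eval {inp : Input w} {A B : Matrix (Fin d) (Fin d) Bool}
    (hA : inp 1 = entry A w) (hB : inp 2 = entry B w)
    (hw : order d + 2 < 2 ^ w) (hs : Setup d s) {X Y x y : ℕ} (hX : 16 ≤ X) (hY : 16 ≤ Y)
    (hx : (s.reg X).toNat = x) (hy : (s.reg Y).toNat = y)
    (h13 : s.reg 13 = BitVec.ofNat w 0) :
    Frame s ((layerCode X Y).eval inp s) ∧ ((layerCode X Y).eval inp s).reg 13 =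
      BitVec.ofNat w (if y < deg d x then nbr d (extend A) (extend B) x y else 0) := by
  obtain ⟨t3, t4, t5, t6, t7, t8, t9⟩ := hs.toNat hw
  have eX : ∀ v, ((s.set 11 v).reg X).toNat = x := fun v => by
    rw [Store.set_reg_of_ne _ _ (by omega), hx]
  have eY : ∀ v, ((s.set 11 v).reg Y).toNat = y := fun v => by
    rw [Store.set_reg_of_ne _ _ (by omega), hy]
  have e11x : ∀ u ≤ x, ((s.set 11 (BitVec.ofNat w (x - u))).reg 11).toNat = x - u := by
    intro u _
    have hx' := (s.reg X).isLt
    rw [Store.set_reg_self, BitVec.toNat_ofNat, Nat.mod_eq_of_lt (by omega)]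
  have e11y : ∀ u ≤ y, ((s.set 11 (BitVec.ofNat w (y - u))).reg 11).toNat = y - u := by
    intro u _
    have hy' := (s.reg Y).isLt
    rw [Store.set_reg_self, BitVec.toNat_ofNat, Nat.mod_eq_of_lt (by omega)]
  have none : ¬ y < deg d x → Frame s s ∧ s.reg 13 =
      BitVec.ofNat w (if y < deg d x then nbr d (extend A) (extend B) x y else 0) :=
    fun h => ⟨Frame.refl, by rw [if_neg h, h13]⟩
  have deg_eq : deg d x = if x < d then 2 * d else if x < 7 * d then d else 0 := rfl
  rw [layerCode, Code.eval, hx, t3]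
  by_cases h0 : x < d
  · rw [if_pos h0] at deg_eq ⊢
    rw [Code.eval, hy, t3]
    by_cases hyd : y < d
    · rw [if_pos hyd, if_pos (show y < deg d x by omega), nbr_zero_left h0 hyd]
      exact readCode_eval hA hw hs.zero hy hx hs.layer1 hs.layer2 hy (by omega) (by omega)
        (by omega)
    · rw [if_neg hyd, Code.eval, hy, t4]
      by_cases hyd' : y < 2 * d
      · obtain ⟨q, rfl⟩ := Nat.exists_eq_add_of_le (not_lt.1 hyd)
        rw [if_pos hyd', if_pos (show d + q < deg d x by omega), nbr_zero_right h0]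
        have hq := e11y d (by omega)
        rw [Nat.add_sub_cancel_left] at hq
        exact sub_readCode_eval hB hw hs.zero hy t3 (by omega) (eX _)
          (by rw [Nat.add_sub_cancel_left, hq]) hs.layer4 hs.layer5
          (by rw [Nat.add_sub_cancel_left, hq]) (by omega) (by omega) (by omega)
      · rw [if_neg hyd']
        exact none (by omega)
  rw [if_neg h0] at deg_eq ⊢
  rw [Code.eval, hy, t3]
  by_cases hyd : y < d
  swap
  · rw [if_neg hyd]
    exact none (by split_ifs at deg_eq <;> omega)
  rw [if_pos hyd]
  by_cases h7 : x < 7 * d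
  swap
  · rw [if_neg h7] at deg_eq
    simp only [Code.eval, hx, t4, t5, t6, t7, t8, t9]
    rw [if_neg (by omega), if_neg (by omega), if_neg (by omega), if_neg (by omega),
      if_neg (by omega), if_neg (by omega)]
    exact none (by omega)
  rw [if_pos h7] at deg_eq
  rw [if_pos (show y < deg d x by omega), Code.eval, hx, t4]
  by_cases h2 : x < 2 * d
  · obtain ⟨p, rfl⟩ := Nat.exists_eq_add_of_le (not_lt.1 h0)
    rw [if_pos h2, nbr_one (by omega)]
    have hp := e11x d (by omega)
    rw [Nat.add_sub_cancel_left] at hp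
    have := sub_readCode_eval hA hw hs.zero hx t3 (by omega)
      (by rw [Nat.add_sub_cancel_left, hp]) (eY _) hs.zero hs.layer3 (eY _) (by omega)
      (by omega) (by omega)
    rwa [Nat.zero_add] at this
  rw [if_neg h2, Code.eval, hx, t5]
  by_cases h3 : x < 3 * d
  · obtain ⟨p, rfl⟩ := Nat.exists_eq_add_of_le (not_lt.1 h2)
    rw [if_pos h3, nbr_two (by omega)]
    have hp := e11x (2 * d) (by omega)
    rw [Nat.add_sub_cancel_left] at hp
    have := sub_readCode_eval hA hw hs.zero hx t4 (by omega)
      (by rw [Nat.add_sub_cancel_left, hp]) (eY _) hs.layer3 hs.zero (eY _) (by omega)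
      (by omega) (by omega)
    rwa [Nat.zero_add] at this
  rw [if_neg h3, Code.eval, hx, t6]
  by_cases h4 : x < 4 * d
  · obtain ⟨p, rfl⟩ := Nat.exists_eq_add_of_le (not_lt.1 h3)
    rw [if_pos h4, nbr_three (by omega)]
    have hp := e11x (3 * d) (by omega)
    rw [Nat.add_sub_cancel_left] at hp
    exact sub_readCode_eval hA hw hs.zero hx t5 (by omega) (eY _)
      (by rw [Nat.add_sub_cancel_left, hp]) hs.layer2 hs.layer1 (eY _) (by omega)
      (by omega) (by omega)
  rw [if_neg h4, Code.eval, hx, t7]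
  by_cases h5 : x < 5 * d
  · obtain ⟨p, rfl⟩ := Nat.exists_eq_add_of_le (not_lt.1 h4)
    rw [if_pos h5, nbr_four (by omega)]
    have hp := e11x (4 * d) (by omega)
    rw [Nat.add_sub_cancel_left] at hp
    have := sub_readCode_eval hB hw hs.zero hx t6 (by omega) (eY _)
      (by rw [Nat.add_sub_cancel_left, hp]) hs.zero hs.layer6 (eY _) (by omega)
      (by omega) (by omega)
    rwa [Nat.zero_add] at this
  rw [if_neg h5, Code.eval, hx, t8]
  by_cases h6 : x < 6 * d
  · obtain ⟨p, rfl⟩ := Nat.exists_eq_add_of_le (not_lt.1 h5)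
    rw [if_pos h6, nbr_five (by omega)]
    have hp := e11x (5 * d) (by omega)
    rw [Nat.add_sub_cancel_left] at hp
    have := sub_readCode_eval hB hw hs.zero hx t7 (by omega) (eY _)
      (by rw [Nat.add_sub_cancel_left, hp]) hs.layer6 hs.zero (eY _) (by omega)
      (by omega) (by omega)
    rwa [Nat.zero_add] at this
  obtain ⟨p, rfl⟩ := Nat.exists_eq_add_of_le (not_lt.1 h6)
  rw [if_neg h6, Code.eval, hx, t9, if_pos h7, nbr_six]
  have hp := e11x (6 * d) (by omega)
  rw [Nat.add_sub_cancel_left] at hp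
  exact sub_readCode_eval hB hw hs.zero hx t8 (by omega)
    (by rw [Nat.add_sub_cancel_left, hp]) (eY _) hs.layer5 hs.layer4 (eY _) (by omega)
    (by omega) (by omega)

theorem nbrCode_eval {inp : Input w} {A B : Matrix (Fin d) (Fin d) Bool}
    (hA : inp 1 = entry A w) (hB : inp 2 = entry B w)
    (hw : order d + 2 < 2 ^ w) (hs : Setup d s) {X Y : ℕ} (hX : 16 ≤ X) (hY : 16 ≤ Y) :
    Frame s ((nbrCode X Y).eval inp s) ∧ ((nbrCode X Y).eval inp s).reg 13 =
      BitVec.ofNat w (if (s.reg Y).toNat < deg d (s.reg X).toNat then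
        nbr d (extend A) (extend B) (s.reg X).toNat (s.reg Y).toNat else 0) := by
  have hf : Frame s (s.set 13 (BitVec.ofNat w 0)) := Frame.refl.set _ (by omega) (by omega)
  have := layerCode_eval hA hB hw (hs.frame hf) hX hY
    (congrArg BitVec.toNat (hf.2 X (.inr hX))) (congrArg BitVec.toNat (hf.2 Y (.inr hY)))
    (Store.set_reg_self _ _ _)
  exact ⟨hf.trans this.1, this.2⟩

end APSD.Product

/-! ## Simulation of a program on the graph -/

namespace APSD.Product

open WordRAM BMM

variable {w d : ℕ} {s s' s'' : Store w}

/-- If the triple in registers `X`, `Y`, `Z` says that a row and a column of the product have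
distance two, then mark the corresponding entry of array `0`. -/
def emitCode (X Y Z : ℕ) : Code :=
  .ifEq Z 2 (.ifLt X 3 .skip (.ifLt X 4 (.ifLt Y 6 .skip (.ifLt Y 7
    (.op .sub 11 X 3 ;; .op .sub 12 Y 6 ;; .load 13 1 11 ;; .op .add 13 13 12 ;; .store 0 13 1)
    .skip)) .skip)) .skip

theorem ofNat_inj_of_lt {m n : ℕ} (hm : m < 2 ^ w) (hn : n < 2 ^ w) :
    BitVec.ofNat w m = BitVec.ofNat w n ↔ m = n := by
  refine ⟨fun h => ?_, fun h => h ▸ rfl⟩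
  have := congrArg BitVec.toNat h
  rwa [BitVec.toNat_ofNat, BitVec.toNat_ofNat, Nat.mod_eq_of_lt hm, Nat.mod_eq_of_lt hn] at this

theorem mul_add_inj {i j i' j' : ℕ} (hj : j < d) (hj' : j' < d) :
    i * d + j = i' * d + j' ↔ i = i' ∧ j = j' := by
  refine ⟨fun h => ?_, fun ⟨h, h'⟩ => h ▸ h' ▸ rfl⟩
  have hmod := congrArg (· % d) h
  simp only [Nat.mul_add_mod', Nat.mod_eq_of_lt hj, Nat.mod_eq_of_lt hj'] at hmod
  subst hmod
  exact ⟨Nat.eq_of_mul_eq_mul_right (by omega) (Nat.add_right_cancel h), rfl⟩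

theorem mul_add_lt {i j : ℕ} (hi : i < d) (hj : j < d) : i * d + j < d * d :=
  calc i * d + j < i * d + d := by omega
    _ = (i + 1) * d := by ring
    _ ≤ d * d := Nat.mul_le_mul_right _ hi

/-- The address of an entry is its tabulated row offset plus its column. Distinct entries have
distinct addresses, as these stay below `d * d` and hence below `2 ^ w`, so exactly one entry is
marked. -/
theorem emitCode_eval {inp : Input w} (hw : order d + 2 < 2 ^ w) (hs : Setup d s) {X Y Z : ℕ}
    (hY : 16 ≤ Y) :
    (∀ r, r ≤ 10 ∨ 16 ≤ r → ((emitCode X Y Z).eval inp s).reg r = s.reg r) ∧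
    (∀ a, a ≠ 0 → ((emitCode X Y Z).eval inp s).mem a = s.mem a) ∧
    ∀ i < d, ∀ j < d, ((emitCode X Y Z).eval inp s).mem 0 (BitVec.ofNat w (i * d + j)) =
      if (d + i, 4 * d + j, 2) = ((s.reg X).toNat, (s.reg Y).toNat, (s.reg Z).toNat) then
        BitVec.ofNat w 1 else s.mem 0 (BitVec.ofNat w (i * d + j)) := by
  obtain ⟨t3, t4, -, t6, t7, -, -⟩ := hs.toNat hw
  have skip : (∀ i < d, ∀ j < d,
      (d + i, 4 * d + j, 2) ≠ ((s.reg X).toNat, (s.reg Y).toNat, (s.reg Z).toNat)) →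
      (∀ r, r ≤ 10 ∨ 16 ≤ r → s.reg r = s.reg r) ∧ (∀ a, a ≠ 0 → s.mem a = s.mem a) ∧
      ∀ i < d, ∀ j < d, s.mem 0 (BitVec.ofNat w (i * d + j)) =
        if (d + i, 4 * d + j, 2) = ((s.reg X).toNat, (s.reg Y).toNat, (s.reg Z).toNat) then
          BitVec.ofNat w 1 else s.mem 0 (BitVec.ofNat w (i * d + j)) :=
    fun h => ⟨fun _ _ => rfl, fun _ _ => rfl, fun i hi j hj => by rw [if_neg (h i hi j hj)]⟩
  have hz : s.reg Z = s.reg 2 ↔ (s.reg Z).toNat = 2 := by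
    rw [← BitVec.toNat_inj, hs.two, BitVec.toNat_ofNat, Nat.mod_eq_of_lt (by omega)]
  rw [emitCode, Code.eval]
  by_cases h2 : s.reg Z = s.reg 2
  swap
  · rw [if_neg h2]
    exact skip fun i _ j _ e => h2 (hz.2 (by simp only [Prod.mk.injEq] at e; omega))
  rw [if_pos h2, Code.eval, t3]
  by_cases hx : (s.reg X).toNat < d
  · rw [if_pos hx]
    exact skip fun i _ j _ e => by simp only [Prod.mk.injEq] at e; omega
  rw [if_neg hx, Code.eval, t4]
  by_cases hx' : (s.reg X).toNat < 2 * d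
  swap
  · rw [if_neg hx']
    exact skip fun i _ j _ e => by simp only [Prod.mk.injEq] at e; omega
  rw [if_pos hx', Code.eval, t6]
  by_cases hy : (s.reg Y).toNat < 4 * d
  · rw [if_pos hy]
    exact skip fun i _ j _ e => by simp only [Prod.mk.injEq] at e; omega
  rw [if_neg hy, Code.eval, t7]
  by_cases hy' : (s.reg Y).toNat < 5 * d
  swap
  · rw [if_neg hy']
    exact skip fun i _ j _ e => by simp only [Prod.mk.injEq] at e; omega
  rw [if_pos hy']
  obtain ⟨p, hp⟩ := Nat.exists_eq_add_of_le (not_lt.1 hx)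
  obtain ⟨q, hq⟩ := Nat.exists_eq_add_of_le (not_lt.1 hy)
  have ep : s.reg X - s.reg 3 = BitVec.ofNat w p := by
    rw [sub_eq_ofNat (by omega), t3, hp, Nat.add_sub_cancel_left]
  have eq : s.reg Y - s.reg 6 = BitVec.ofNat w q := by
    rw [sub_eq_ofNat (by omega), t6, hq, Nat.add_sub_cancel_left]
  have hYn : Y ≠ 11 := by omega
  simp only [Code.eval, BinOp.eval, Store.set_mem, Store.set_reg, hYn, ep, eq, if_true, if_false,
    Nat.reduceEqDiff, hs.rows p (by omega), ← BitVec.ofNat_add, OfNat.one_ne_ofNat, hs.one]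
  refine ⟨fun r hr => ?_, fun a ha => ?_, fun i hi j hj => ?_⟩
  · rw [if_neg (by omega), if_neg (by omega), if_neg (by omega), if_neg (by omega)]
  · rw [Function.update_of_ne ha]
  · have h1 := mul_add_lt hi hj
    have h3 := mul_add_lt (show p < d by omega) (show q < d by omega)
    have h4 : d * d ≤ order d := Nat.le_add_right _ _
    simp only [Function.update_self, Function.update_apply,
      ofNat_inj_of_lt (h1.trans (show d * d < 2 ^ w by omega))
        (h3.trans (show d * d < 2 ^ w by omega)),
      mul_add_inj hj (show q < d by omega), hp, hq, hz.1 h2, Prod.mk.injEq, add_right_inj,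
      and_true, true_and]

/-- `s` represents the configuration `c` of the simulated machine: its registers and arrays are
shifted, and array `0` holds the product matrix as far as it is known from the output. -/
structure Simulates {w : ℕ} (d : ℕ) (s : Store w) (c : Config w) : Prop where
  setup : Setup d s
  reg : ∀ r, s.reg (r + 16) = c.reg r
  mem : ∀ a, s.mem (a + 2) = c.mem a
  out : ∀ i < d, ∀ j < d, s.mem 0 (BitVec.ofNat w (i * d + j)) =
    if (d + i, 4 * d + j, 2) ∈ c.out then BitVec.ofNat w 1 else BitVec.ofNat w 0

theorem Simulates.frame {c : Config w} (h : Simulates d s c) (hf : Frame s s') :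
    Simulates d s' c where
  setup := h.setup.frame hf
  reg r := (hf.2 _ (.inr (by omega))).trans (h.reg r)
  mem := by rw [hf.1]; exact h.mem
  out := by rw [hf.1]; exact h.out

theorem Simulates.set {c : Config w} (h : Simulates d s c) (r : ℕ) (v : BitVec w) (p : ℕ) :
    Simulates d (s.set (r + 16) v) { c with pc := p, reg := Function.update c.reg r v } where
  setup := h.setup.of_eq (fun q hq => Store.set_reg_of_ne _ _ (by omega)) rfl
  reg q := by simp [Store.set_reg, Function.update_apply, h.reg]
  mem := h.mem
  out := h.out

/-- The effect on the simulating machine of an instruction that is not a jump. -/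
def simCode : Instr → Code
  | .const r v => .const (r + 16) v
  | .op o r x y => .op o (r + 16) (x + 16) (y + 16)
  | .load r a x => .load (r + 16) (a + 2) (x + 16)
  | .store a x y => .store (a + 2) (x + 16) (y + 16)
  | .input r 0 _ _ => .op .add (r + 16) 10 0
  | .input r 1 x _ => degCode (x + 16) ;; .op .add (r + 16) 13 0
  | .input r 2 x y => nbrCode (x + 16) (y + 16) ;; .op .add (r + 16) 13 0
  | .input r _ _ _ => .const (r + 16) 0
  | .emit x y z => emitCode (x + 16) (y + 16) (z + 16)
  | .jumpEq _ _ _ | .jumpLt _ _ _ => .skip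

/-- The jumps to the next block, where block `l` starts at address `off + 100 * l`. -/
def simJump (off next : ℕ) : Instr → List Instr
  | .jumpEq x y l => [.jumpEq (x + 16) (y + 16) (off + 100 * l), .jumpEq 0 0 next]
  | .jumpLt x y l => [.jumpLt (x + 16) (y + 16) (off + 100 * l), .jumpEq 0 0 next]
  | _ => [.jumpEq 0 0 next]

/-- The instructions that simulate the `k`-th instruction `i` of a program, padded to length
`100`. -/
def block (off k : ℕ) (i : Instr) : List Instr :=
  ((simCode i).compile (off + 100 * k) ++ simJump off (off + 100 * (k + 1)) i).rightpad 100
    (.const 0 0)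

/-- Together with at most two jumps this fits into a block of length `100`. -/
theorem simCode_len_le (i : Instr) : (simCode i).len ≤ 98 := by
  rcases i with _ | _ | _ | _ | ⟨r, _ | _ | _ | k, x, y⟩ | _ | _ | _ <;>
    simp [simCode, Code.len, degCode, nbrCode, layerCode, readCode, emitCode]

theorem length_block (off k : ℕ) (i : Instr) : (block off k i).length = 100 := by
  have h := simCode_len_le i
  have h' : ∀ n, (simJump off n i).length ≤ 2 := by intro n; cases i <;> simp [simJump]
  have := h' (off + 100 * (k + 1))
  rw [block, List.rightpad, List.length_append, List.length_replicate, List.length_append, Code.length_compile]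
  omega

/-- The blocks for the program `P`, the first one having number `k`. -/
def simulate (off : ℕ) : ℕ → Program → List Instr
  | _, [] => []
  | k, i :: P => block off k i ++ simulate off (k + 1) P

theorem length_simulate (off k : ℕ) (P : Program) :
    (simulate off k P).length = 100 * P.length := by
  induction P generalizing k with
  | nil => rfl
  | cons i P ih => simp [simulate, length_block, ih]; omega

/-- Equal block lengths turn a jump target of the simulated program into an address by a linear
formula. -/
theorem codeAt_block {Q P : Program} {off k j : ℕ} {i : Instr}
    (h : CodeAt Q (off + 100 * k) (simulate off k P)) (hj : P[j]? = some i) :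
    CodeAt Q (off + 100 * (k + j)) (block off (k + j) i) := by
  induction P generalizing k j with
  | nil => simp at hj
  | cons i' P ih =>
    cases j with
    | zero =>
      obtain rfl : i' = i := by simpa using hj
      exact h.left
    | succ j =>
      have h' := h.right
      rw [length_block, add_assoc, ← mul_add_one] at h'
      have := ih h' (by simpa using hj)
      rwa [add_assoc, add_comm 1] at this

theorem usesOnly_simulate {S : Set BinOp} (hadd : BinOp.add ∈ S) (hsub : BinOp.sub ∈ S)
    (off k : ℕ) {P : Program} (hP : UsesOnly S P) : UsesOnly S (simulate off k P) := by
  induction P generalizing k with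
  | nil => intro o r x y h; simp [simulate] at h
  | cons i P ih =>
    refine UsesOnly.append ?_ (ih _ fun o r x y h => hP o r x y (List.mem_cons_of_mem _ h))
    refine UsesOnly.append (UsesOnly.append (Code.OpsIn.usesOnly ?_ _) ?_) ?_
    · rcases i with _ | ⟨o, r, x, y⟩ | _ | _ | ⟨r, _ | _ | _ | k, x, y⟩ | _ | _ | _ <;>
        simp [simCode, Code.OpsIn, degCode, nbrCode, layerCode, readCode, emitCode, hadd, hsub]
      exact hP o r x y List.mem_cons_self
    · intro o r x y h; cases i <;> simp [simJump] at h
    · intro o r x y h; simp at h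

/-- One step of the simulated machine. -/
theorem simulates_step {Q P : Program} {off : ℕ} {A B : Matrix (Fin d) (Fin d) Bool}
    (hQ : CodeAt Q off (simulate off 0 P)) (hw : order d + 2 < 2 ^ w) {c : Config w}
    (h : Simulates d s c) :
    ∃ s', Simulates d s' (step P (graphInput (adjList d (extend A) (extend B)) w) c) ∧
      Reaches Q (matrixInput A B w) 100 (s.toConfig (off + 100 * c.pc))
        (s'.toConfig (off +
          100 * (step P (graphInput (adjList d (extend A) (extend B)) w) c).pc)) := by
  rcases hi : P[c.pc]? with _ | i
  -- A halted machine stays put, which is simulated by zero steps.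
  · simp only [step, hi]
    exact ⟨s, h, Reaches.refl _ _⟩
  simp only [step, hi]
  have hb := codeAt_block (k := 0) hQ hi
  rw [zero_add, block, List.rightpad] at hb
  have hc := hb.left.left
  have hj := hb.left.right
  rw [Code.length_compile] at hj
  have hlen := simCode_len_le i
  have run := Reaches.code (inp := matrixInput A B w) hc s
  -- For everything but jumps, the block is straight code followed by a jump to the next block; the
  -- padding is skipped.
  have pure : ∀ L, simJump off (off + 100 * (c.pc + 1)) i =
      .jumpEq 0 0 (off + 100 * (c.pc + 1)) :: L →
      Reaches Q (matrixInput A B w) 100 (s.toConfig (off + 100 * c.pc))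
        (((simCode i).eval (matrixInput A B w) s).toConfig (off + 100 * (c.pc + 1))) := by
    intro L e
    rw [e] at hj
    exact (run.trans (Reaches.jump hj _)).mono (by omega)
  have zero_add' : ∀ x : BitVec w, x + BitVec.ofNat w 0 = x := fun x => BitVec.add_zero x
  match i, hi, hj, hlen, run, pure with
  | .const r v, _, _, _, _, pure => exact ⟨_, h.set r _ _, pure _ rfl⟩
  | .op o r x y, _, _, _, _, pure =>
    refine ⟨_, ?_, pure _ rfl⟩
    simp only [simCode, Code.eval, h.reg]
    exact h.set r _ _
  | .load r a x, _, _, _, _, pure =>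
    refine ⟨_, ?_, pure _ rfl⟩
    simp only [simCode, Code.eval, h.reg, h.mem]
    exact h.set r _ _
  | .store a x y, _, _, _, _, pure =>
    refine ⟨_, ?_, pure _ rfl⟩
    simp only [simCode, Code.eval, h.reg, h.mem]
    refine ⟨h.setup.of_eq (fun _ _ => rfl) ?_, h.reg, fun b => ?_, ?_⟩
    · simp only [Function.update_of_ne (show 1 ≠ a + 2 by omega)]
    · simp [Instr.exec, Function.update_apply, h.mem]
    · simp only [Function.update_of_ne (show 0 ≠ a + 2 by omega)]; exact h.out
  | .input r 0 x y, _, _, _, _, pure =>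
    refine ⟨_, ?_, pure _ rfl⟩
    simp only [simCode, Code.eval, BinOp.eval, h.setup.order, h.setup.zero, zero_add']
    exact h.set r _ _
  | .input r 1 x y, _, _, _, _, pure =>
    refine ⟨_, ?_, pure _ rfl⟩
    obtain ⟨hf, hr⟩ := degCode_eval (inp := matrixInput A B w) hw h.setup (x + 16)
    have h' := h.frame hf
    simp only [simCode, Code.eval, BinOp.eval, hr, h'.setup.zero, zero_add', h.reg, Instr.exec,
      graphInput_one]
    exact h'.set r _ _
  | .input r 2 x y, _, _, _, _, pure =>
    refine ⟨_, ?_, pure _ rfl⟩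
    obtain ⟨hf, hr⟩ := nbrCode_eval (inp := matrixInput A B w) (A := A) (B := B) rfl rfl hw
      h.setup (X := x + 16) (Y := y + 16) (by omega) (by omega)
    have h' := h.frame hf
    simp only [simCode, Code.eval, BinOp.eval, hr, h'.setup.zero, zero_add', h.reg, Instr.exec,
      graphInput_two]
    exact h'.set r _ _
  | .input r (k + 3) x y, _, _, _, _, pure => exact ⟨_, h.set r _ _, pure _ rfl⟩
  | .emit x y z, _, _, _, _, pure =>
    refine ⟨_, ?_, pure _ rfl⟩
    obtain ⟨hr, hm, ho⟩ := emitCode_eval (inp := matrixInput A B w) hw h.setup (X := x + 16)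
      (Y := y + 16) (Z := z + 16) (by omega)
    refine ⟨h.setup.of_eq (fun r hr' => hr r (.inl hr')) (hm 1 (by omega)),
      fun r => (hr _ (.inr (by omega))).trans (h.reg r),
      fun a => (hm _ (by omega)).trans (h.mem a), fun i hi j hj => ?_⟩
    rw [simCode, ho i hi j hj, h.out i hi j hj]
    simp only [Instr.exec, List.mem_append, List.mem_singleton, h.reg]
    split_ifs <;> simp_all
  | .jumpEq x y l, _, hj, _, _, _ =>
    refine ⟨s, ⟨h.setup, h.reg, h.mem, h.out⟩, ?_⟩
    have e := hj.step (c := s.toConfig _) (inp := matrixInput A B w)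
    simp only [Store.exec_jumpEq, h.reg] at e
    by_cases hxy : c.reg x = c.reg y
    · rw [if_pos hxy] at e
      simp only [Instr.exec, if_pos hxy]
      exact (Reaches.single e).mono (by omega)
    · rw [if_neg hxy] at e
      simp only [Instr.exec, if_neg hxy]
      exact ((Reaches.single e).trans (Reaches.jump hj.tail _)).mono (by omega)
  | .jumpLt x y l, _, hj, _, _, _ =>
    refine ⟨s, ⟨h.setup, h.reg, h.mem, h.out⟩, ?_⟩
    have e := hj.step (c := s.toConfig _) (inp := matrixInput A B w)
    simp only [Store.exec_jumpLt, h.reg] at e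
    by_cases hxy : (c.reg x).toNat < (c.reg y).toNat
    · rw [if_pos hxy] at e
      simp only [Instr.exec, if_pos hxy]
      exact (Reaches.single e).mono (by omega)
    · rw [if_neg hxy] at e
      simp only [Instr.exec, if_neg hxy]
      exact ((Reaches.single e).trans (Reaches.jump hj.tail _)).mono (by omega)

theorem simulates_run {Q P : Program} {off : ℕ} {A B : Matrix (Fin d) (Fin d) Bool}
    (hQ : CodeAt Q off (simulate off 0 P)) (hw : order d + 2 < 2 ^ w) {c : Config w}
    (h : Simulates d s c) (t : ℕ) :
    ∃ s', Simulates d s' ((step P (graphInput (adjList d (extend A) (extend B)) w))^[t] c) ∧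
      Reaches Q (matrixInput A B w) (100 * t) (s.toConfig (off + 100 * c.pc))
        (s'.toConfig (off + 100 *
          ((step P (graphInput (adjList d (extend A) (extend B)) w))^[t] c).pc)) := by
  induction t with
  | zero => exact ⟨s, h, Reaches.refl _ _⟩
  | succ t ih =>
    obtain ⟨s₁, h₁, r₁⟩ := ih
    obtain ⟨s₂, h₂, r₂⟩ := simulates_step (A := A) (B := B) hQ hw h₁
    rw [Function.iterate_succ_apply']
    exact ⟨s₂, h₂, (r₁.trans r₂).mono (by omega)⟩

end APSD.Product

/-! ## Initialization -/

namespace APSD.Product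

open WordRAM BMM

/-- Load the constants, except for the number of vertices. -/
def constCode : Code :=
  .const 0 0 ;; .const 1 1 ;; .const 2 2 ;; .input 3 0 0 0 ;; .op .add 4 3 3 ;; .op .add 5 4 3 ;;
    .op .add 6 5 3 ;; .op .add 7 6 3 ;; .op .add 8 7 3 ;; .op .add 9 8 3 ;; .const 11 0 ;;
    .const 12 0 ;; .const 13 0

/-- The body of the loop that writes the row offsets. -/
def rowBody : Code := .store 1 11 12 ;; .op .add 12 12 3 ;; .op .add 11 11 1

/-- The body of the loop that clears array `0`. -/
def clearBody : Code := .store 0 13 0 ;; .op .add 13 13 1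

/-- Initialize the simulating machine. -/
def initProgram : Program :=
  constCode.compile 0 ++ (whileLt 11 3 rowBody 13 ++ (whileLt 13 12 clearBody 19 ++
    (Code.op .add 10 12 9).compile 24))

theorem length_initProgram : initProgram.length = 25 := rfl

variable {w d : ℕ}

/-- Offsets `j * d` come from repeated addition, as multiplication need not be available. At `i =
d`, register `12` is left with `d * d`, the bound of the clearing loop. -/
theorem rowBody_iterate {inp : Input w} (hw : order d + 2 < 2 ^ w) {s : Store w}
    (h1 : s.reg 1 = BitVec.ofNat w 1) (h3 : s.reg 3 = BitVec.ofNat w d)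
    (h11 : s.reg 11 = BitVec.ofNat w 0) (h12 : s.reg 12 = BitVec.ofNat w 0) {i : ℕ} (hi : i ≤ d) :
    ((rowBody.eval inp)^[i] s).reg 11 = BitVec.ofNat w i ∧
    ((rowBody.eval inp)^[i] s).reg 12 = BitVec.ofNat w (i * d) ∧
    (∀ r, r ≠ 11 → r ≠ 12 → ((rowBody.eval inp)^[i] s).reg r = s.reg r) ∧
    (∀ a, a ≠ 1 → ((rowBody.eval inp)^[i] s).mem a = s.mem a) ∧
    ∀ j < i, ((rowBody.eval inp)^[i] s).mem 1 (BitVec.ofNat w j) = BitVec.ofNat w (j * d) := by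
  induction i with
  | zero => simp [h11, h12]
  | succ i ih =>
    obtain ⟨e11, e12, er, em, ej⟩ := ih (by omega)
    rw [Function.iterate_succ_apply']
    generalize (rowBody.eval inp)^[i] s = t at *
    have e1 := (er 1 (by omega) (by omega)).trans h1
    have e3 := (er 3 (by omega) (by omega)).trans h3
    refine ⟨?_, ?_, fun r hr hr' => ?_, fun a ha => ?_, fun j hj => ?_⟩
    · simp [rowBody, Code.eval, Store.set_reg, BinOp.eval, e11, e1, BitVec.ofNat_add]
    · simp [rowBody, Code.eval, Store.set_reg, BinOp.eval, e12, e3, add_mul, BitVec.ofNat_add]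
    · simp [rowBody, Code.eval, Store.set_reg, hr, hr', er]
    · simp [rowBody, Code.eval, ha, em]
    · have hd : 7 * d ≤ order d := Nat.le_add_left _ _
      simp only [rowBody, Code.eval, Store.set_mem, Function.update_self, Function.update_apply,
        e11, e12, ofNat_inj_of_lt (show j < 2 ^ w by omega) (show i < 2 ^ w by omega)]
      split_ifs with h
      · rw [h]
      · exact ej j (by omega)

theorem clearBody_iterate {inp : Input w} {s : Store w} (h0 : s.reg 0 = BitVec.ofNat w 0)
    (h1 : s.reg 1 = BitVec.ofNat w 1) (h13 : s.reg 13 = BitVec.ofNat w 0) (i : ℕ) :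
    ((clearBody.eval inp)^[i] s).reg 13 = BitVec.ofNat w i ∧
    (∀ r, r ≠ 13 → ((clearBody.eval inp)^[i] s).reg r = s.reg r) ∧
    (∀ a, a ≠ 0 → ((clearBody.eval inp)^[i] s).mem a = s.mem a) ∧
    ∀ j < i, ((clearBody.eval inp)^[i] s).mem 0 (BitVec.ofNat w j) = BitVec.ofNat w 0 := by
  induction i with
  | zero => simp [h13]
  | succ i ih =>
    obtain ⟨e13, er, em, ej⟩ := ih
    rw [Function.iterate_succ_apply']
    generalize (clearBody.eval inp)^[i] s = t at *
    have e0 := (er 0 (by omega)).trans h0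
    have e1 := (er 1 (by omega)).trans h1
    refine ⟨?_, fun r hr => ?_, fun a ha => ?_, fun j hj => ?_⟩
    · simp [clearBody, Code.eval, BinOp.eval, e13, e1, BitVec.ofNat_add]
    · simp [clearBody, Code.eval, Store.set_reg, hr, er]
    · simp [clearBody, Code.eval, ha, em]
    · simp only [clearBody, Code.eval, Store.set_mem, Function.update_self,
        Function.update_apply, e13, e0]
      split_ifs with h
      · rfl
      · exact ej j (by by_contra hji; exact h (by rw [show j = i by omega]))

theorem constCode_eval {A B : Matrix (Fin d) (Fin d) Bool} (μ : Memory w) {s : Store w}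
    (hs : s = constCode.eval (matrixInput A B w) ⟨fun _ => 0, μ⟩) :
    (s.reg 0 = BitVec.ofNat w 0 ∧ s.reg 1 = BitVec.ofNat w 1 ∧ s.reg 2 = BitVec.ofNat w 2 ∧
      s.reg 3 = BitVec.ofNat w d ∧ s.reg 4 = BitVec.ofNat w (2 * d) ∧
      s.reg 5 = BitVec.ofNat w (3 * d) ∧ s.reg 6 = BitVec.ofNat w (4 * d) ∧
      s.reg 7 = BitVec.ofNat w (5 * d) ∧ s.reg 8 = BitVec.ofNat w (6 * d) ∧
      s.reg 9 = BitVec.ofNat w (7 * d)) ∧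
    s.reg 11 = BitVec.ofNat w 0 ∧ s.reg 12 = BitVec.ofNat w 0 ∧ s.reg 13 = BitVec.ofNat w 0 ∧
    (∀ r, s.reg (r + 16) = 0) ∧ s.mem = μ := by
  have e2 : 2 * d = d + d := by ring
  have e3 : 3 * d = d + d + d := by ring
  have e4 : 4 * d = d + d + d + d := by ring
  have e5 : 5 * d = d + d + d + d + d := by ring
  have e6 : 6 * d = d + d + d + d + d + d := by ring
  have e7 : 7 * d = d + d + d + d + d + d + d := by ring
  subst hs
  simp only [e2, e3, e4, e5, e6, e7, BitVec.ofNat_add]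
  simp [constCode, Code.eval, Store.set_reg, BinOp.eval, matrixInput]

/-- The simulated machine starts on the arrays from number `2` on, with whatever content they have;
only arrays `0` and `1` are written here. -/
theorem initProgram_reaches {A B : Matrix (Fin d) (Fin d) Bool} {Q : Program}
    (hQ : CodeAt Q 0 initProgram) (hw : order d + 2 < 2 ^ w) (μ : Memory w) :
    ∃ s, Simulates d s (Config.init fun a => μ (a + 2)) ∧
      Reaches Q (matrixInput A B w) (5 * d + 4 * (d * d) + 18) (Config.init μ)
        (s.toConfig 25) := by
  have hd : order d = d * d + 7 * d := rfl
  have c₂ := hQ.right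
  have c₃ := c₂.right
  have c₄ := c₃.right
  have r₁ := Reaches.code (inp := matrixInput A B w) hQ.left ⟨fun _ => 0, μ⟩
  obtain ⟨⟨e0, e1, e2, e3, e4, e5, e6, e7, e8, e9⟩, e11, e12, e13, er, em⟩ :=
    constCode_eval (A := A) (B := B) μ rfl
  generalize constCode.eval (matrixInput A B w) ⟨fun _ => 0, μ⟩ = s₁ at *
  have row := fun i (hi : i ≤ d) => rowBody_iterate (inp := matrixInput A B w) hw e1 e3 e11 e12 hi
  have r₂ := Reaches.whileLt (inp := matrixInput A B w) c₂.left d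
    (fun i => (rowBody.eval (matrixInput A B w))^[i] s₁)
    (fun i _ => Function.iterate_succ_apply' _ _ _)
    (fun i hi => by
      rw [toNat_reg hw (row i hi.le).1 (by omega),
        toNat_reg hw (((row i hi.le).2.2.1 3 (by omega) (by omega)).trans e3) (by omega)]
      exact hi)
    (by
      rw [toNat_reg hw (row d le_rfl).1 (by omega),
        toNat_reg hw (((row d le_rfl).2.2.1 3 (by omega) (by omega)).trans e3) (by omega)]
      exact lt_irrefl _)
  obtain ⟨-, f12, fr, fm, frows⟩ := row d le_rfl
  simp only [Function.iterate_zero, id] at r₂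
  generalize (rowBody.eval (matrixInput A B w))^[d] s₁ = s₂ at *
  have clear := clearBody_iterate (inp := matrixInput A B w)
    ((fr 0 (by omega) (by omega)).trans e0) ((fr 1 (by omega) (by omega)).trans e1)
    ((fr 13 (by omega) (by omega)).trans e13)
  have r₃ := Reaches.whileLt (inp := matrixInput A B w) c₃.left (d * d)
    (fun i => (clearBody.eval (matrixInput A B w))^[i] s₂)
    (fun i _ => Function.iterate_succ_apply' _ _ _)
    (fun i hi => by
      rw [toNat_reg hw (clear i).1 (by omega),
        toNat_reg hw (((clear i).2.1 12 (by omega)).trans f12) (by omega)]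
      exact hi)
    (by
      rw [toNat_reg hw (clear (d * d)).1 (by omega),
        toNat_reg hw (((clear (d * d)).2.1 12 (by omega)).trans f12) (by omega)]
      exact lt_irrefl _)
  obtain ⟨-, gr, gm, gclear⟩ := clear (d * d)
  simp only [Function.iterate_zero, id] at r₃
  generalize (clearBody.eval (matrixInput A B w))^[d * d] s₂ = s₃ at *
  have r₄ := Reaches.code (inp := matrixInput A B w) c₄ s₃
  have hreg : ∀ r, r ≠ 11 → r ≠ 12 → r ≠ 13 → s₃.reg r = s₁.reg r := fun r h h' h'' =>
    (gr r h'').trans (fr r h h')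
  refine ⟨_, ?_, (((r₁.trans r₂).trans r₃).trans r₄).mono ?_⟩
  · have hset : ∀ r, r ≠ 10 → r ≠ 11 → r ≠ 12 → r ≠ 13 →
        ((Code.op .add 10 12 9).eval (matrixInput A B w) s₃).reg r = s₁.reg r :=
      fun r h h₁ h₂ h₃ => (Store.set_reg_of_ne _ _ h).trans (hreg r h₁ h₂ h₃)
    refine ⟨⟨?_, ?_, ?_, ?_, ?_, ?_, ?_, ?_, ?_, ?_, ?_, ?_⟩, fun r => ?_, fun a => ?_,
      fun i hi j hj => ?_⟩
    any_goals first
      | rwa [hset _ (by omega) (by omega) (by omega) (by omega)]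
    -- Register `12` still holds `d * d` and register `9` holds `7 * d`; their sum is the number of
    -- vertices.
    · simp only [Code.eval, BinOp.eval, Store.set_reg_self, order, BitVec.ofNat_add]
      rw [gr 12 (by omega), f12, hreg 9 (by omega) (by omega) (by omega), e9]
    · intro i hi
      exact (congrFun (gm 1 (by omega)) _).trans (frows i hi)
    · rw [hset _ (by omega) (by omega) (by omega) (by omega), er]; rfl
    · exact ((gm _ (by omega)).trans (fm _ (by omega))).trans (by rw [em]; rfl)
    · exact gclear _ (mul_add_lt hi hj)
  · simp only [constCode, rowBody, clearBody, Code.len]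
    ring_nf; omega

end APSD.Product

/-! ## The reduction -/

namespace WordRAM

variable {w : ℕ} {P : Program} {inp : Input w} {μ : Memory w}

theorem run_add_of_halted {T : ℕ} (h : Halted P (run P inp μ T)) (t : ℕ) :
    run P inp μ (T + t) = run P inp μ T := by
  induction t with
  | zero => rfl
  | succ t ih =>
    have : run P inp μ (T + (t + 1)) = step P inp (run P inp μ (T + t)) :=
      Function.iterate_succ_apply' _ _ _
    rw [this, ih, step, List.getElem?_eq_none h]

theorem out_prefix_step (c : Config w) : c.out <+: (step P inp c).out := by
  unfold step
  split
  · rename_i i _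
    cases i <;> first | exact List.prefix_rfl | exact List.prefix_append _ _
  · exact List.prefix_rfl

theorem out_prefix_run {s t : ℕ} (h : s ≤ t) : (run P inp μ s).out <+: (run P inp μ t).out := by
  induction t, h using Nat.le_induction with
  | base => exact List.prefix_rfl
  | succ t _ ih =>
    have : run P inp μ (t + 1) = step P inp (run P inp μ t) :=
      Function.iterate_succ_apply' _ _ _
    rw [this]
    exact ih.trans (out_prefix_step _)

/-- Preprocessing time and delay bound the total time. -/
theorem HasDelay.exists_halted {pre D L : ℕ} {q : ℚ} (h : HasDelay P inp μ pre q)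
    (hq : q ≤ D) (hL : ∀ t, (run P inp μ t).out.length ≤ L) :
    ∃ T ≤ pre + (L + 1) * D, Halted P (run P inp μ T) := by
  -- By time `pre + k * D` there are `k` outputs unless the machine has halted. The last conjunct
  -- keeps the delay guarantee applicable.
  have key : ∀ k, ∃ t ≤ pre + k * D, Halted P (run P inp μ t) ∨
      (k ≤ (run P inp μ t).out.length ∧ (pre ≤ t ∨ (run P inp μ t).out ≠ [])) := by
    intro k
    induction k with
    | zero => exact ⟨pre, by omega, .inr ⟨Nat.zero_le _, .inl le_rfl⟩⟩
    | succ k ih =>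
      obtain ⟨t, ht, hh | ⟨hk, hp⟩⟩ := ih
      · exact ⟨t, ht.trans (by gcongr; omega), .inl hh⟩
      by_cases hh : Halted P (run P inp μ t)
      · exact ⟨t, ht.trans (by gcongr; omega), .inl hh⟩
      obtain ⟨s, hs, h'⟩ := h t hh hp
      have hs' : s ≤ t + D := by
        have : (s : ℚ) ≤ t + D := hs.trans (by gcongr)
        exact_mod_cast this
      refine ⟨s, by rw [add_mul]; omega, h'.imp_right fun hlt => ⟨by omega, .inr ?_⟩⟩
      intro e
      rw [e] at hlt
      simp at hlt
  -- More than `L` outputs are impossible, so at `k = L + 1` the machine must have halted.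
  obtain ⟨t, ht, hh | ⟨hk, -⟩⟩ := key (L + 1)
  · exact ⟨t, ht, hh⟩
  · have := hL t
    omega

theorem Enumerates.of_halted {X : Set (ℕ × ℕ × ℕ)} (h : Enumerates P inp μ X) {t : ℕ}
    (ht : Halted P (run P inp μ t)) : ∀ x, x ∈ (run P inp μ t).out ↔ x ∈ X := by
  obtain ⟨T, hT, -, hX⟩ := h
  have : run P inp μ t = run P inp μ T := by
    rcases le_total t T with hle | hle
    · obtain ⟨k, rfl⟩ := Nat.exists_eq_add_of_le hle
      exact (run_add_of_halted ht k).symm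
    · obtain ⟨k, rfl⟩ := Nat.exists_eq_add_of_le hle
      exact run_add_of_halted hT k
  rwa [this]

theorem Enumerates.out_length_le {X : Set (ℕ × ℕ × ℕ)} (h : Enumerates P inp μ X) {L : ℕ}
    (hL : ∀ l : List (ℕ × ℕ × ℕ), l.Nodup → (∀ x ∈ l, x ∈ X) → l.length ≤ L) (t : ℕ) :
    (run P inp μ t).out.length ≤ L := by
  obtain ⟨T, hT, hnd, hX⟩ := h
  have h1 := (out_prefix_run (P := P) (inp := inp) (μ := μ) (Nat.le_add_left t T)).length_le
  rw [run_add_of_halted hT] at h1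
  exact h1.trans (hL _ hnd fun x hx => (hX x).1 hx)

end WordRAM

/-! ### Word size, running time and correctness of the multiplication program -/

namespace APSD.Product

open WordRAM BMM

/-- The number of vertices is at most cubic in `d + 2`; rounding the logarithm costs another factor
of two, since `Nat.log 2 (d + 2)` is at least `1`. -/
theorem log_order_le (d : ℕ) : Nat.log 2 (order d + 2) < 6 * Nat.log 2 (d + 2) := by
  have hL : 1 ≤ Nat.log 2 (d + 2) := Nat.log_pos (by omega) (by omega)
  refine Nat.log_lt_of_lt_pow (by omega) ?_
  have h1 : d + 2 < 2 ^ (Nat.log 2 (d + 2) + 1) := Nat.lt_pow_succ_log_self (by omega) _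
  calc order d + 2 ≤ (d + 2) ^ 3 := by
        have : 0 ≤ d ^ 3 := Nat.zero_le _
        unfold order; ring_nf; nlinarith
    _ < (2 ^ (Nat.log 2 (d + 2) + 1)) ^ 3 := Nat.pow_lt_pow_left h1 (by omega)
    _ = 2 ^ ((Nat.log 2 (d + 2) + 1) * 3) := (pow_mul _ _ _).symm
    _ ≤ 2 ^ (6 * Nat.log 2 (d + 2)) := Nat.pow_le_pow_right (by omega) (by omega)

/-- The program that multiplies matrices by simulating `P` on the product graph. -/
def mulProgram (P : Program) : Program := initProgram ++ simulate 25 0 P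

theorem usesOnly_mulProgram {S : Set BinOp} (hadd : BinOp.add ∈ S) (hsub : BinOp.sub ∈ S)
    {P : Program} (hP : UsesOnly S P) : UsesOnly S (mulProgram P) := by
  refine UsesOnly.append ?_ (usesOnly_simulate hadd hsub _ _ hP)
  intro o r x y h
  simp [initProgram, constCode, whileLt, rowBody, clearBody, Code.compile] at h
  have : o = .add := by tauto
  exact this ▸ hadd

theorem mulProgram_solves {κ : GraphKind} {P : Program} (hP : SolvesReachableAPSD κ P) :
    SolvesInQuadraticTime (mulProgram P) := by
  obtain ⟨k, C, hP⟩ := hP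
  -- The factor `6` is that of `log_order_le`, and `k + 1` instead of `k` makes words long enough
  -- for vertex numbers even if `k = 0`. The time constant covers `100 * 912` for the simulation,
  -- plus the initialization.
  refine ⟨6 * (k + 1), 100000 * (C + 1), fun d A B w hkw μ => ?_⟩
  have hlog := log_order_le d
  have hkw' : 6 * Nat.log 2 (d + 2) * (k + 1) ≤ w := le_trans (le_of_eq (by ring)) hkw
  have hw : order d + 2 < 2 ^ w := by
    refine (Nat.lt_pow_succ_log_self (b := 2) (by omega) _).trans_le
      (Nat.pow_le_pow_right (by omega) (le_trans ?_ hkw'))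
    exact hlog.trans_le (Nat.le_mul_of_pos_right _ (by omega))
  have hk : k * Nat.log 2 (order d + 2) ≤ w := by
    refine le_trans ?_ hkw'
    rw [mul_comm]
    exact Nat.mul_le_mul hlog.le (by omega)
  -- `P` works on every initial memory, in particular on the uninitialized arrays left to it.
  obtain ⟨henum, hdelay⟩ := hP (order d) (graph d (extend A) (extend B))
    (adjList d (extend A) (extend B)) (admits κ) isAdjLists w hk fun a => μ (a + 2)
  -- Here `15` is `1` plus the bound `14` on the average degree.
  obtain ⟨T, hT, hhalt⟩ := hdelay.exists_halted (D := C * 15)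
    (by
      have := avgDegree_le (d := d) (a := extend A) (b := extend B)
      push_cast
      gcongr
      linarith)
    (henum.out_length_le fun l => length_le_of_mem_reachableTriples)
  obtain ⟨s₀, h₀, r₀⟩ := initProgram_reaches (A := A) (B := B) (Q := mulProgram P)
    ⟨[], simulate 25 0 P, rfl, rfl⟩ hw μ
  obtain ⟨s, hs, r⟩ := simulates_run (A := A) (B := B) (Q := mulProgram P) (P := P) (off := 25)
    ⟨initProgram, [], by simp [mulProgram], rfl⟩ hw h₀ T
  obtain ⟨n, hn, e⟩ := r₀.trans r
  refine ⟨n, hn.trans ?_, ?_, fun i j => ?_⟩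
  · have hm := numEdges_le (d := d) (a := extend A) (b := extend B) κ
    have hdd : d ≤ d * d := Nat.le_mul_self d
    have h1 : T ≤ C * (order d + 49 * (d * d) + 1) + (order d + 49 * (d * d) + 1) * (C * 15) :=
      hT.trans (by gcongr)
    have h2 : order d ≤ 8 * (d * d) := by unfold order; omega
    have h3 : T ≤ (C + 1) * (912 * (d * d + 1)) := by
      refine h1.trans ?_
      have : order d + 49 * (d * d) + 1 ≤ 57 * (d * d + 1) := by omega
      calc _ = (order d + 49 * (d * d) + 1) * (16 * C) := by ring
        _ ≤ 57 * (d * d + 1) * (16 * (C + 1)) := by gcongr; omega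
        _ = _ := by ring
    have h4 : 1 * (d * d + 1) ≤ (C + 1) * (d * d + 1) := by gcongr; omega
    rw [pow_two, mul_assoc]
    rw [show (C + 1) * (912 * (d * d + 1)) = 912 * ((C + 1) * (d * d + 1)) by ring] at h3
    omega
  -- A program counter beyond the end of `P` corresponds to an address beyond the last block, so
  -- both machines halt together.
  · rw [show run (mulProgram P) (matrixInput A B w) μ n = _ from e]
    have : P.length ≤ ((step P (graphInput (adjList d (extend A) (extend B)) w))^[T]
      (Config.init fun a => μ (a + 2))).pc := hhalt
    simp only [Halted, mulProgram, List.length_append, length_initProgram, length_simulate,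
      Store.toConfig]
    omega
  · rw [show run (mulProgram P) (matrixInput A B w) μ n = _ from e]
    have hout := Simulates.out (c := run P _ _ T) hs i i.2 j j.2
    have hmem := (henum.of_halted hhalt (d + i, 4 * d + j, 2)).trans
      ((mem_reachableTriples_iff i.2 j.2).trans (boolMul_iff A B i j).symm)
    simp only [Store.toConfig]
    rw [hout]
    by_cases hb : boolMul A B i j = true
    · rw [if_pos (hmem.2 hb), if_pos hb, BitVec.toNat_ofNat, Nat.mod_eq_of_lt (by omega)]
    · rw [if_neg fun h => hb (hmem.1 h), if_neg hb]; simp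

end APSD.Product

/-- Reachable-APSD enumeration with preprocessing in `O(n + m)` and delay in the order of the
average degree, on directed or on undirected graphs, is impossible unless Boolean `d × d` matrix
multiplication can be solved in `O(d ^ 2)` total time on the same word RAM. `S` is the set of unit
cost word operations of that RAM, next to comparisons, reading and writing. -/
theorem mainTheorem4 (κ : APSD.GraphKind) (S : Set WordRAM.BinOp)
    (hadd : WordRAM.BinOp.add ∈ S) (hsub : WordRAM.BinOp.sub ∈ S)
    (hBMM : ¬ ∃ Q : WordRAM.Program, WordRAM.UsesOnly S Q ∧ BMM.SolvesInQuadraticTime Q) :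
    ¬ ∃ P : WordRAM.Program, WordRAM.UsesOnly S P ∧ APSD.SolvesReachableAPSD κ P := by
  rintro ⟨P, hP, h⟩
  exact hBMM ⟨APSD.Product.mulProgram P, APSD.Product.usesOnly_mulProgram hadd hsub hP,
    APSD.Product.mulProgram_solves h⟩
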